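/- All graphs are finite and simple. For a graph $H$ and $n\ge 1$, let the regular Turán number $\mathrm{ex}_r(n,H)$ be the largest $k$ for which there is a $k$-regular graph on $n$ vertices that does not contain $H$ as a (not necessarily induced) subgraph. Let $K^{=}_{2x,y}$ denote the complete bipartite graph $K_{2x,y}$ together with the edges of a perfect matching inside the part of size $2x$, and let $|H|$ be the number of vertices of $H$. Let $H$ be a graph with chromatic number $\chi(H)=3$. (i) Suppose that for every vertex $v$ of $H$ the graph $H\setminus v$ is not bipartite, or that $H$ is not a subgraph of $K^{=}_{2|H|,|H|}$. Then $\mathrm{ex}_r(n,H)=\frac n2+o(n)$ as $n\to\infty$ (over all $n$, even and odd). (ii) If neither condition in (i) holds, then there is a number $N$ depending on $H$ such that $\mathrm{ex}_r(n,H)\le 2\left\lfloor \frac n5\right\rfloor$ for all odd $n\ge N$. -/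

import Mathlib

open scoped Asymptotics

open Classical in
/-- The regular Turán number of `H`: the largest `k` for which there is a `k`-regular graph on `n`
vertices that does not contain `H` as a (not necessarily induced) subgraph. If `H` has an edge and
`n ≠ 0`, this set is nonempty and bounded and the supremum is its maximum, see
`isGreatest_regularTuranNumber`. -/
noncomputable def regularTuranNumber {V : Type*} (n : ℕ) (H : SimpleGraph V) : ℕ :=
  sSup {k : ℕ | ∃ G : SimpleGraph (Fin n), G.IsRegularOfDegree k ∧ ¬ H.IsContained G}

open Classical in
theorem isGreatest_regularTuranNumber {V : Type*} {n : ℕ} (hn : n ≠ 0) {H : SimpleGraph V}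
    (hH : H ≠ ⊥) :
    IsGreatest {k : ℕ | ∃ G : SimpleGraph (Fin n), G.IsRegularOfDegree k ∧ ¬ H.IsContained G}
      (regularTuranNumber n H) := by
  have hbdd : BddAbove
      {k : ℕ | ∃ G : SimpleGraph (Fin n), G.IsRegularOfDegree k ∧ ¬ H.IsContained G} := by
    refine ⟨n, ?_⟩
    rintro k ⟨G, hG, -⟩
    have h1 := G.degree_lt_card_verts ⟨0, Nat.pos_of_ne_zero hn⟩
    rw [hG.degree_eq, Fintype.card_fin] at h1
    exact h1.le
  refine ⟨Nat.sSup_mem ⟨0, ⊥, fun v => by simp, ?_⟩ hbdd, fun k hk => le_csSup hbdd hk⟩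
  rintro ⟨f⟩
  apply hH
  ext a b
  exact ⟨fun h => (f.toHom.map_adj h).elim, fun h => h.elim⟩

/-- The graph `K_{2x,y}^=`: the complete bipartite graph with parts `Fin x × Bool` (of size `2x`)
and `Fin y`, together with a perfect matching in the part of size `2x`, whose edges join
`(i, false)` and `(i, true)`. -/
def matchedCompleteBipartiteGraph (x y : ℕ) : SimpleGraph ((Fin x × Bool) ⊕ Fin y) :=
  completeBipartiteGraph (Fin x × Bool) (Fin y) ⊔
    SimpleGraph.fromRel fun u v => ∃ i : Fin x, u = Sum.inl (i, false) ∧ v = Sum.inl (i, true)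

section
open Finset
open scoped Classical

universe u

/-! Part (i). The upper bound is the minimum degree form of Erdős–Stone
(`regularTuranNumber_upper_bound`). For the lower bound, `K_{m,m}` serves even `n`. For `n = 2m + 1`
take a nearly complete biregular graph of even degree between two sets of size `m`, delete a
matching from it and repair the degrees with one further vertex, the apex. Either the apex is joined
to both ends of each deleted edge, so that removing it leaves a bipartite graph; or it is joined to
the right ends only and the left ends are matched among themselves, so that the graph lies in some
`K^=_{2x,y}`. Each condition in (i) excludes `H` from one of these graphs.

Part (ii). Let `G` be `k`-regular on an odd number `n` of vertices and `H`-free, with `k > 2⌊n/5⌋`.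
Then `k` is even, hence `5k > 2n`. As `H` minus some vertex is bipartite and `H` lies in a
`K^=_{2x,y}`, `G` contains neither a vertex joined to a large complete bipartite graph (`HasWheel`)
nor a large matching with many common neighbors (`HasMatched`). The absence of wheels leaves few
triangles, so triangle removal and an Andrásfai-type argument
(`bipartite_or_pentagon_of_cliqueFree`) show that `G` is nearly bipartite or nearly homomorphic to a
pentagon. Again because there are no wheels, the exceptional vertices can be put into classes too,
and then every vertex has few wrong edges.

Yet regularity forces linearly many wrong edges: in the bipartite case the classes differ in size
because `n` is odd; in the pentagon case `5k > 2n` makes the two classes around some class too small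
to absorb degree `k`. Wrong edges have small maximum degree, so they contain a large matching
(`exists_matching`), and the ends of each of them have linearly many common neighbors.
`exists_complete_pair` turns this into `HasMatched`, a contradiction. -/

/-- The number of elements with a property. -/
noncomputable def cnt {α : Type*} [Fintype α] (p : α → Prop) : ℕ := #{x | p x}

/-! ### Counting elements with a property -/

section cnt
variable {α β : Type*} [Fintype α] [Fintype β] {p q r : α → Prop}

theorem cnt_eq_card (p : α → Prop) [DecidablePred p] : cnt p = #{x | p x} := by
  unfold cnt
  congr

theorem cnt_congr (h : ∀ x, p x ↔ q x) : cnt p = cnt q := by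
  simp [cnt, h]

theorem cnt_mono (h : ∀ x, p x → q x) : cnt p ≤ cnt q := by
  unfold cnt
  gcongr with x
  exact h x

theorem cnt_true : cnt (fun _ : α => True) = Fintype.card α := by simp [cnt]

theorem cnt_false : cnt (fun _ : α => False) = 0 := by simp [cnt]

theorem cnt_le_card (p : α → Prop) : cnt p ≤ Fintype.card α :=
  card_le_univ _

theorem cnt_and_add_cnt_and_not (p q : α → Prop) :
    cnt (fun x => p x ∧ q x) + cnt (fun x => p x ∧ ¬ q x) = cnt p := by
  simp only [cnt]
  rw [← filter_filter, ← filter_filter]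
  exact card_filter_add_card_filter_not _

theorem cnt_add_cnt_not (p : α → Prop) :
    cnt p + cnt (fun x => ¬ p x) = Fintype.card α := by
  rw [← cnt_true, ← cnt_and_add_cnt_and_not (fun _ : α => True) p]
  simp

theorem cnt_le_add (h : ∀ x, p x → q x ∨ r x) : cnt p ≤ cnt q + cnt r := by
  unfold cnt
  refine le_trans (card_le_card ?_) (card_union_le _ _)
  intro x
  simpa using h x

theorem cnt_eq_add (h : ∀ x, p x ↔ q x ∨ r x) (hd : ∀ x, q x → ¬ r x) :
    cnt p = cnt q + cnt r := by
  rw [← cnt_and_add_cnt_and_not p q]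
  congr 1
  · exact cnt_congr fun x => by grind
  · exact cnt_congr fun x => by grind

theorem cnt_eq_one_of {a : α} (h : ∀ x, p x ↔ x = a) : cnt p = 1 := by
  simp only [cnt, h]
  exact card_eq_one.2 ⟨a, by ext; simp⟩

theorem cnt_mem (s : Finset α) : cnt (fun x => x ∈ s) = #s := by
  simp [cnt]

theorem cnt_le_of_injective (f : α → β) (hf : Function.Injective f) {q : β → Prop}
    (h : ∀ x, p x → q (f x)) : cnt p ≤ cnt q := by
  unfold cnt
  exact card_le_card_of_injOn f (fun x hx => by simpa using h x (by simpa using hx)) hf.injOn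

theorem cnt_sum (p : α ⊕ β → Prop) :
    cnt p = cnt (fun x => p (Sum.inl x)) + cnt (fun x => p (Sum.inr x)) := by
  simp only [cnt, card_filter]
  rw [Fintype.sum_sum_type]

theorem cnt_option_of (p : Option α → Prop) (h : p none) :
    cnt p = cnt (fun x => p (some x)) + 1 := by
  simp only [cnt, card_filter]
  rw [Fintype.sum_option, if_pos h, add_comm]

theorem cnt_option_of_not (p : Option α → Prop) (h : ¬ p none) :
    cnt p = cnt (fun x => p (some x)) := by
  simp only [cnt, card_filter]
  rw [Fintype.sum_option, if_neg h, zero_add]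

theorem exists_cnt_eq {k : ℕ} (hk : k ≤ Fintype.card α) : ∃ p : α → Prop, cnt p = k := by
  obtain ⟨s, -, hs⟩ := exists_subset_card_eq (s := (univ : Finset α)) hk
  exact ⟨fun x => x ∈ s, by rw [cnt_mem, hs]⟩

theorem cnt_ne (a : α) : cnt (fun x => x ≠ a) + 1 = Fintype.card α := by
  rw [← cnt_add_cnt_not (fun x => x ≠ a)]
  congr 1
  exact (cnt_eq_one_of (a := a) fun x => by simp).symm

end cnt

/-! ### Lower bounds: constructions -/

theorem le_regularTuranNumber {V W : Type*} [Fintype W] {H : SimpleGraph V} (G : SimpleGraph W)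
    {n k : ℕ} (hn : Fintype.card W = n) (hreg : ∀ v, cnt (G.Adj v) = k)
    (hfree : ¬ H.IsContained G) (hkn : k ≤ n) : k ≤ regularTuranNumber n H := by
  -- For `n = 0` every `k` is vacuously a degree of regularity and the set may be unbounded; then `k
  -- ≤ n` leaves only `k = 0`.
  have hbdd : BddAbove
      {k : ℕ | ∃ G : SimpleGraph (Fin n), G.IsRegularOfDegree k ∧ ¬ H.IsContained G} ∨ n = 0 := by
    rcases Nat.eq_zero_or_pos n with h | h
    · exact Or.inr h
    · refine Or.inl ⟨n, ?_⟩
      rintro k ⟨G, hG, -⟩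
      have h1 := G.degree_lt_card_verts ⟨0, h⟩
      rw [hG.degree_eq, Fintype.card_fin] at h1
      exact h1.le
  rcases hbdd with hbdd | rfl
  swap
  · omega
  refine le_csSup hbdd ?_
  let e : W ≃ Fin n := Fintype.equivFinOfCardEq hn
  let i : G.comap e.symm ≃g G := SimpleGraph.Iso.comap e.symm G
  refine ⟨G.comap e.symm, ?_, ?_⟩
  · intro v
    rw [← i.degree_eq, ← hreg (i v), ← SimpleGraph.card_neighborFinset_eq_degree, cnt]
    congr 1
    ext w
    simp
  · rintro ⟨f⟩
    exact hfree ⟨i.toCopy.comp f⟩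

/-- A graph on `2 |W| + 1` vertices: a bipartite graph `B` between two copies of `W`, a graph `M`
on the left copy and one further vertex joined to `P` on the left and `Q` on the right. -/
def apexAdj {W : Type*} (B M : W → W → Prop) (P Q : W → Prop) :
    Option (W ⊕ W) → Option (W ⊕ W) → Prop
  | none, none => False
  | none, some (Sum.inl i) => P i
  | some (Sum.inl i), none => P i
  | none, some (Sum.inr i) => Q i
  | some (Sum.inr i), none => Q i
  | some (Sum.inl i), some (Sum.inl j) => M i j
  | some (Sum.inl i), some (Sum.inr j) => B i j
  | some (Sum.inr j), some (Sum.inl i) => B i j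
  | some (Sum.inr _), some (Sum.inr _) => False

def apexGraph {W : Type*} (B M : W → W → Prop) (P Q : W → Prop) (hM : ∀ i j, M i j → M j i)
    (hM' : ∀ i, ¬ M i i) : SimpleGraph (Option (W ⊕ W)) where
  Adj := apexAdj B M P Q
  symm := ⟨by
    rintro (_ | i | i) (_ | j | j) h
    all_goals first | exact h | exact hM _ _ h⟩
  loopless := ⟨by
    rintro (_ | i | i) h
    exacts [h, hM' i h, h]⟩

theorem apexGraph_regular {W : Type*} [Fintype W] {B M : W → W → Prop} {P Q : W → Prop}
    (hM : ∀ i j, M i j → M j i) (hM' : ∀ i, ¬ M i i) {k : ℕ} (h0 : cnt P + cnt Q = k)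
    (h1 : ∀ i, P i → cnt (M i) + cnt (B i) + 1 = k)
    (h1' : ∀ i, ¬ P i → cnt (M i) + cnt (B i) = k)
    (h2 : ∀ j, Q j → cnt (fun i => B i j) + 1 = k)
    (h2' : ∀ j, ¬ Q j → cnt (fun i => B i j) = k) (v : Option (W ⊕ W)) :
    cnt ((apexGraph B M P Q hM hM').Adj v) = k := by
  rcases v with _ | i | i
  · rw [cnt_option_of_not _ id, cnt_sum]
    exact h0
  · by_cases hi : P i
    · rw [cnt_option_of _ hi, cnt_sum]
      exact h1 i hi
    · rw [cnt_option_of_not _ hi, cnt_sum]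
      exact h1' i hi
  · by_cases hi : Q i
    · rw [cnt_option_of _ hi, cnt_sum]
      change cnt (fun j => B j i) + cnt (fun _ : W => False) + 1 = k
      rw [cnt_false]
      exact h2 i hi
    · rw [cnt_option_of_not _ hi, cnt_sum]
      change cnt (fun j => B j i) + cnt (fun _ : W => False) = k
      rw [cnt_false]
      exact h2' i hi

theorem cnt_and_not_add_one {W : Type*} [Fintype W] {R : W → Prop} {i : W} (hR : R i) :
    cnt (fun j => R j ∧ j ≠ i) + 1 = cnt R := by
  rw [← cnt_and_add_cnt_and_not R (fun j => j ≠ i)]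
  congr 1
  exact (cnt_eq_one_of (a := i) fun x => by grind).symm

theorem exists_perm_ne {W : Type*} [Fintype W] (h : 2 ≤ Fintype.card W) :
    ∃ π : Equiv.Perm W, ∀ x, π x ≠ x := by
  obtain ⟨m, hm⟩ := Nat.exists_eq_add_of_le' h
  let e : W ≃ Fin (m + 2) := Fintype.equivFinOfCardEq hm
  refine ⟨(e.trans (finRotate _)).trans e.symm, fun x hx => ?_⟩
  simp [Equiv.symm_apply_eq] at hx

/-- A `2h`-regular bipartite graph between two copies of a set of size `2h + r`, `r ≤ 1`. -/
theorem exists_biregular {W : Type*} [Fintype W] {h r : ℕ} (hr : r ≤ 1) (h1 : 1 ≤ h)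
    (hW : Fintype.card W = 2 * h + r) :
    ∃ B : W → W → Prop, (∀ i, B i i) ∧ (∀ i, cnt (B i) = 2 * h) ∧
      ∀ j, cnt (fun i => B i j) = 2 * h := by
  rcases Nat.le_one_iff_eq_zero_or_eq_one.1 hr with rfl | rfl
  · exact ⟨fun _ _ => True, by simp, fun _ => by rw [cnt_true, hW]; rfl,
      fun _ => by rw [cnt_true, hW]; rfl⟩
  -- Deleting the perfect matching given by `π` lowers all degrees by one. As `π` has no fixed
  -- point, the diagonal edges survive; the constructions below delete some of them.
  · obtain ⟨π, hπ⟩ := exists_perm_ne (W := W) (by omega)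
    refine ⟨fun i j => j ≠ π i, fun i => (hπ i).symm, fun i => ?_, fun j => ?_⟩
    · have := cnt_ne (π i)
      change cnt (fun j => j ≠ π i) = 2 * h
      omega
    · have := cnt_ne (π.symm j)
      have h2 : cnt (fun i => j ≠ π i) = cnt (fun i => i ≠ π.symm j) :=
        cnt_congr fun i => by rw [Ne, Ne, Equiv.eq_symm_apply, eq_comm]
      change cnt (fun i => j ≠ π i) = 2 * h
      omega

/-- The index types may be larger than `V`, but only pairs that are hit matter. Naming each such
pair by a chosen vertex of `V` mapped into it shows that `|V|` pairs suffice. -/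
theorem isContained_matchedCompleteBipartiteGraph {V I J : Type*} [Fintype V] {H : SimpleGraph V}
    (g : V → (I × Bool) ⊕ J) (hg : Function.Injective g)
    (h1 : ∀ u v i b i' b', H.Adj u v → g u = Sum.inl (i, b) → g v = Sum.inl (i', b') → i = i')
    (h2 : ∀ u v j j', H.Adj u v → g u = Sum.inr j → g v = Sum.inr j' → False) :
    H.IsContained (matchedCompleteBipartiteGraph (Fintype.card V) (Fintype.card V)) := by
  let e := Fintype.equivFin V
  let key : V → I ⊕ J := fun v => Sum.map Prod.fst id (g v)
  have hex : ∀ v, ∃ u, key u = key v := fun v => ⟨v, rfl⟩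
  let r : V → V := fun v => (hex v).choose
  have hr : ∀ v, key (r v) = key v := fun v => (hex v).choose_spec
  have hr' : ∀ u v, key u = key v → r u = r v := fun u v h => by simp only [r, h]
  let φ : V → (Fin (Fintype.card V) × Bool) ⊕ Fin (Fintype.card V) :=
    fun v => Sum.map (fun p => (e (r v), p.2)) (fun _ => e v) (g v)
  have hφ1 : ∀ v i b, g v = Sum.inl (i, b) → φ v = Sum.inl (e (r v), b) := fun v i b h => by
    simp [φ, h]
  have hφ2 : ∀ v j, g v = Sum.inr j → φ v = Sum.inr (e v) := fun v j h => by simp [φ, h]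
  refine ⟨⟨⟨φ, fun {u v} huv => ?_⟩, fun u v huv => ?_⟩⟩
  · rcases hu : g u with ⟨i, b⟩ | j <;> rcases hv : g v with ⟨i', b'⟩ | j'
    · rw [hφ1 u i b hu, hφ1 v i' b' hv]
      have hi := h1 u v i b i' b' huv hu hv
      subst hi
      have hb : b ≠ b' := by
        rintro rfl
        exact huv.ne (hg (hu.trans hv.symm))
      rw [hr' u v (by simp [key, hu, hv])]
      cases b <;> cases b' <;> simp_all [matchedCompleteBipartiteGraph]
    · rw [hφ1 u i b hu, hφ2 v j' hv]
      simp [matchedCompleteBipartiteGraph]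
    · rw [hφ2 u j hu, hφ1 v i' b' hv]
      simp [matchedCompleteBipartiteGraph]
    · exact (h2 u v j j' huv hu hv).elim
  · change φ u = φ v at huv
    rcases hu : g u with ⟨i, b⟩ | j <;> rcases hv : g v with ⟨i', b'⟩ | j'
    · rw [hφ1 u i b hu, hφ1 v i' b' hv] at huv
      simp only [Sum.inl.injEq, Prod.mk.injEq, EmbeddingLike.apply_eq_iff_eq] at huv
      have h3 := hr u
      rw [huv.1, hr v] at h3
      simp only [key, hu, hv, Sum.map_inl, Sum.inl.injEq] at h3
      apply hg
      rw [hu, hv, ← h3, huv.2]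
    · rw [hφ1 u i b hu, hφ2 v j' hv] at huv
      cases huv
    · rw [hφ2 u j hu, hφ1 v i' b' hv] at huv
      cases huv
    · rw [hφ2 u j hu, hφ2 v j' hv] at huv
      simpa using huv

theorem card_option_sum {W : Type*} [Fintype W] :
    Fintype.card (Option (W ⊕ W)) = 2 * Fintype.card W + 1 := by
  rw [Fintype.card_option, Fintype.card_sum]
  ring

/-- If no vertex deletion makes `H` bipartite, then a bipartite graph with one more vertex is
`H`-free. -/
theorem le_regularTuranNumber_of_forall_not_isBipartite {V : Type*} {H : SimpleGraph V}
    (hH : ¬ H.Colorable 2) (hv : ∀ v : V, ¬ (H.induce {v}ᶜ).IsBipartite) {m h r : ℕ} (hr : r ≤ 1)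
    (h1 : 1 ≤ h) (hm : m = 2 * h + r) : 2 * h ≤ regularTuranNumber (2 * m + 1) H := by
  obtain ⟨B, hB, hB1, hB2⟩ := exists_biregular (W := Fin m) hr h1 (by simp [hm])
  obtain ⟨P, hP⟩ := exists_cnt_eq (α := Fin m) (k := h) (by simp; omega)
  -- The apex gets `h` neighbors on each side; each of them has lost its diagonal edge in exchange.
  let G := apexGraph (fun i j => B i j ∧ ¬ (i = j ∧ P i)) (fun _ _ => False) P P
    (fun _ _ h => h) (fun _ h => h)
  refine le_regularTuranNumber G (by rw [card_option_sum, Fintype.card_fin])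
    (apexGraph_regular _ _ (by omega) (fun i hi => ?_) (fun i hi => ?_) (fun i hi => ?_)
    (fun i hi => ?_)) ?_ (by omega)
  · rw [cnt_false, zero_add, ← hB1 i, ← cnt_and_not_add_one (hB i)]
    congr 1
    exact cnt_congr fun j => by grind
  · rw [cnt_false, zero_add, ← hB1 i]
    exact cnt_congr fun j => by grind
  · rw [← hB2 i, ← cnt_and_not_add_one (R := fun j => B j i) (hB i)]
    congr 1
    exact cnt_congr fun j => by grind
  · rw [← hB2 i]
    exact cnt_congr fun j => by grind
  · rintro ⟨f⟩
    -- If the apex is not used by the copy, any vertex will do; there is one because `H` is not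
    -- 2-colorable.
    have : ∃ v, ∀ u, u ≠ v → f u ≠ none := by
      by_cases h : ∃ v, f v = none
      · obtain ⟨v, hv⟩ := h
        exact ⟨v, fun u hu h' => hu (f.injective (h'.trans hv.symm))⟩
      · push Not at h
        rcases isEmpty_or_nonempty V with hV | ⟨⟨v⟩⟩
        · exact (hH (.of_isEmpty 2)).elim
        · exact ⟨v, fun u _ => h u⟩
    obtain ⟨v, hf⟩ := this
    refine hv v ⟨SimpleGraph.Coloring.mk
      (fun u => match f u.1 with | some (Sum.inl _) => 0 | _ => 1) ?_⟩
    rintro ⟨a, ha⟩ ⟨b, hb⟩ hab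
    have hab' : G.Adj (f a) (f b) := f.toHom.map_adj hab
    have h3 := hf a ha
    have h4 := hf b hb
    rcases hfa : f a with _ | i | i <;> rcases hfb : f b with _ | j | j <;>
      simp_all [G, apexGraph, apexAdj]

/-- If `H` is not contained in any `K^=_{2x,y}`, then a bipartite graph together with a matching
in one of the parts is `H`-free. -/
theorem le_regularTuranNumber_of_not_isContained {V : Type*} [Fintype V] {H : SimpleGraph V}
    (hH : ¬ H.IsContained (matchedCompleteBipartiteGraph (Fintype.card V) (Fintype.card V)))
    {m h r : ℕ} (hr : r ≤ 1)
    (h1 : 1 ≤ h) (hm : m = 2 * h + r) : 2 * h ≤ regularTuranNumber (2 * m + 1) H := by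
  have hW : Fintype.card ((Fin h × Bool) ⊕ Fin r) = m := by
    rw [hm, Fintype.card_sum, Fintype.card_prod, Fintype.card_fin, Fintype.card_bool,
      Fintype.card_fin, mul_comm]
  obtain ⟨B, hB, hB1, hB2⟩ := exists_biregular hr h1 (hW.trans hm)
  let P : (Fin h × Bool) ⊕ Fin r → Prop := fun w => ∃ i, w = Sum.inl i
  let M : (Fin h × Bool) ⊕ Fin r → (Fin h × Bool) ⊕ Fin r → Prop :=
    fun w w' => ∃ i b, w = Sum.inl (i, b) ∧ w' = Sum.inl (i, !b)
  have hP : cnt P = 2 * h := by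
    rw [cnt_sum, cnt_congr (q := fun _ => True) (fun x => iff_of_true ⟨x, rfl⟩ trivial), cnt_true,
      cnt_congr (q := fun _ => False) (fun x => by simp [P]), cnt_false, Fintype.card_prod,
      Fintype.card_fin, Fintype.card_bool, mul_comm, add_zero]
  have hM : ∀ i, P i → cnt (M i) = 1 := by
    rintro _ ⟨⟨i, b⟩, rfl⟩
    refine cnt_eq_one_of (a := Sum.inl (i, !b)) fun j => ?_
    constructor
    · rintro ⟨i', b', h1, h2⟩
      cases h1
      exact h2
    · rintro rfl
      exact ⟨i, b, rfl, rfl⟩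
  have hM' : ∀ i, ¬ P i → cnt (M i) = 0 := by
    intro i hi
    rw [← cnt_false (α := (Fin h × Bool) ⊕ Fin r)]
    refine cnt_congr fun j => ⟨?_, False.elim⟩
    rintro ⟨i', b', rfl, -⟩
    exact hi ⟨_, rfl⟩
  have hMs : ∀ i j, M i j → M j i := by
    rintro _ _ ⟨i, b, rfl, rfl⟩
    exact ⟨i, !b, rfl, by rw [Bool.not_not]⟩
  have hMi : ∀ i, ¬ M i i := by
    rintro _ ⟨i, b, rfl, h⟩
    cases b <;> cases h
  -- A deleted diagonal edge is replaced by an apex edge at its right end and by a matching edge of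
  -- `M` at its left end.
  let G := apexGraph (fun i j => B i j ∧ ¬ (i = j ∧ P i)) M (fun _ => False) P hMs hMi
  refine le_regularTuranNumber G (by rw [card_option_sum, hW])
    (apexGraph_regular _ _ (by rw [hP, cnt_false, zero_add]) (fun i hi => hi.elim)
    (fun i _ => ?_) (fun i hi => ?_) (fun i hi => ?_)) ?_ (by omega)
  · by_cases hi : P i
    · rw [hM i hi, ← hB1 i, ← cnt_and_not_add_one (hB i), add_comm]
      congr 1
      exact cnt_congr fun j => by grind
    · rw [hM' i hi, zero_add, ← hB1 i]
      exact cnt_congr fun j => by grind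
  · rw [← hB2 i, ← cnt_and_not_add_one (R := fun j => B j i) (hB i)]
    congr 1
    exact cnt_congr fun j => by grind
  · rw [← hB2 i]
    exact cnt_congr fun j => by grind
  · rintro ⟨f⟩
    -- The apex has no neighbors on the left, so it joins the left part as half of an additional
    -- pair, and so does the unmatched left vertex if there is one.
    let q : Option (((Fin h × Bool) ⊕ Fin r) ⊕ ((Fin h × Bool) ⊕ Fin r)) →
        (Option (Fin h ⊕ Fin r) × Bool) ⊕ ((Fin h × Bool) ⊕ Fin r)
      | none => Sum.inl (none, false)
      | some (Sum.inl (Sum.inl (i, b))) => Sum.inl (some (Sum.inl i), b)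
      | some (Sum.inl (Sum.inr i)) => Sum.inl (some (Sum.inr i), false)
      | some (Sum.inr j) => Sum.inr j
    have hq : Function.Injective q := by
      rintro (_ | (⟨i, b⟩ | i) | i) (_ | (⟨j, c⟩ | j) | j) h
      all_goals first | rfl | (cases h; rfl) | cases h
    have hG1 : ∀ x y i b i' b', G.Adj x y → q x = Sum.inl (i, b) → q y = Sum.inl (i', b') →
        i = i' := by
      rintro (_ | (⟨i, b⟩ | i) | i) (_ | (⟨j, c⟩ | j) | j) i0 b0 i1 b1 hadj h1 h2 <;>
        cases h1
      all_goals cases h2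
      · rfl
      · exact hadj.elim
      · exact hadj.elim
      · exact hadj.elim
      · obtain ⟨i2, b2, h3, h4⟩ := hadj
        cases h3
        cases h4
        rfl
      · obtain ⟨i2, b2, h3, h4⟩ := hadj
        cases h4
      · exact hadj.elim
      · obtain ⟨i2, b2, h3, h4⟩ := hadj
        cases h3
      · obtain ⟨i2, b2, h3, h4⟩ := hadj
        cases h3
    have hG2 : ∀ x y j j', G.Adj x y → q x = Sum.inr j → q y = Sum.inr j' → False := by
      rintro (_ | (⟨i, b⟩ | i) | i) (_ | (⟨j, c⟩ | j) | j) i0 i1 hadj h1 h2 <;>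
        cases h1
      all_goals cases h2
      exact hadj
    refine hH (isContained_matchedCompleteBipartiteGraph (q ∘ f) (hq.comp f.injective) ?_ ?_)
    · exact fun u v i b i' b' huv => hG1 _ _ _ _ _ _ (f.toHom.map_adj huv)
    · exact fun u v j j' huv => hG2 _ _ _ _ (f.toHom.map_adj huv)

theorem le_regularTuranNumber_two_mul {V : Type*} {H : SimpleGraph V}
    (hH : ¬ H.Colorable 2) (m : ℕ) : m ≤ regularTuranNumber (2 * m) H := by
  refine le_regularTuranNumber (completeBipartiteGraph (Fin m) (Fin m)) (by simp; ring) ?_ ?_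
    (by omega)
  · intro v
    rw [cnt_sum]
    rcases v with v | v <;> simp [completeBipartiteGraph, cnt_true, cnt_false]
  · rintro ⟨f⟩
    refine hH ⟨SimpleGraph.Coloring.mk
      (fun u => match f u with | Sum.inl _ => 0 | _ => 1) ?_⟩
    intro a b hab
    have hab' : (completeBipartiteGraph _ _).Adj (f a) (f b) := f.toHom.map_adj hab
    rcases hfa : f a with i | i <;> rcases hfb : f b with j | j <;> simp_all

theorem regularTuranNumber_lower_bound {V : Type*} [Fintype V] {H : SimpleGraph V}
    (hH : ¬ H.Colorable 2)
    (hc : (∀ v : V, ¬ (H.induce {v}ᶜ).IsBipartite) ∨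
      ¬ H.IsContained (matchedCompleteBipartiteGraph (Fintype.card V) (Fintype.card V)))
    {n : ℕ} (hn : 5 ≤ n) : n ≤ 2 * regularTuranNumber n H + 3 := by
  rcases Nat.even_or_odd' n with ⟨m, rfl | rfl⟩
  · have := le_regularTuranNumber_two_mul hH m
    omega
  -- A regular graph of odd order has even degree; rounding down to `2 * (m / 2)` is what makes the
  -- additive constant 3.
  · have : 2 * (m / 2) ≤ regularTuranNumber (2 * m + 1) H := by
      have hm : m = 2 * (m / 2) + m % 2 := by omega
      rcases hc with hc | hc
      · exact le_regularTuranNumber_of_forall_not_isBipartite hH hc (r := m % 2) (by omega) (by omega) hm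
      · exact le_regularTuranNumber_of_not_isContained hc (r := m % 2) (by omega) (by omega) hm
    omega

/-! ### The asymptotic upper bound from Erdős–Stone -/

theorem regularTuranNumber_upper_bound {V : Type*} [Fintype V] {H : SimpleGraph V}
    (hH : H.Colorable 3) {ε : ℝ} (hε : 0 < ε) :
    ∀ᶠ n : ℕ in Filter.atTop, (regularTuranNumber n H : ℝ) ≤ (1 / 2 + ε) * n := by
  filter_upwards [SimpleGraph.eventually_completeEquipartiteGraph_isContained_of_minDegree hε 2
    (Fintype.card V), Filter.eventually_gt_atTop 0] with n hn hn0
  have : Nonempty (Fin n) := ⟨⟨0, hn0⟩⟩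
  have : regularTuranNumber n H ≤ ⌊(1 / 2 + ε) * n⌋₊ := by
    refine csSup_le' ?_
    rintro k ⟨G, hG, hfree⟩
    by_contra! hk
    refine hfree (SimpleGraph.IsContained.trans ?_ (hn (G := G) ?_))
    · exact SimpleGraph.isContained_completeEquipartiteGraph_of_colorable hH.some _ fun c => Fintype.card_subtype_le _
    · rw [hG.minDegree_eq]
      rw [Nat.floor_lt (by positivity)] at hk
      norm_num
      norm_num at hk
      linarith
  exact (Nat.cast_le.2 this).trans (Nat.floor_le (by positivity))

theorem regularTuranNumber_isLittleO {V : Type*} [Fintype V] {H : SimpleGraph V}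
    (hH3 : H.Colorable 3) (hH : ¬ H.Colorable 2)
    (hc : (∀ v : V, ¬ (H.induce {v}ᶜ).IsBipartite) ∨
      ¬ H.IsContained (matchedCompleteBipartiteGraph (Fintype.card V) (Fintype.card V))) :
    (fun n : ℕ => (regularTuranNumber n H : ℝ) - (n : ℝ) / 2) =o[Filter.atTop]
        (fun n : ℕ => (n : ℝ)) := by
  rw [Asymptotics.isLittleO_iff]
  intro c hc0
  have h3 := tendsto_natCast_atTop_atTop.eventually_ge_atTop (3 / c)
  filter_upwards [regularTuranNumber_upper_bound hH3 hc0, h3, Filter.eventually_ge_atTop 5]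
    with n hn hn3 hn5
  have h1 : (n : ℝ) ≤ 2 * regularTuranNumber n H + 3 := by
    exact_mod_cast regularTuranNumber_lower_bound hH hc hn5
  rw [div_le_iff₀' hc0] at hn3
  rw [Real.norm_of_nonneg (Nat.cast_nonneg n), Real.norm_eq_abs, abs_le]
  constructor <;> linarith

/-! ### Finding wheels and matchings with common neighbors -/

theorem sum_cnt_comm {α β : Type*} [Fintype β] (X : Finset α) (r : α → β → Prop) :
    ∑ x ∈ X, cnt (r x) = ∑ y, #{x ∈ X | r x y} := by
  simp only [cnt, card_filter]
  exact sum_comm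

/-- A bipartite graph in which the vertices of a large part have positive density in the other
part contains a large complete bipartite graph. -/
theorem exists_complete_pair {c : ℝ} (hc : 0 < c) (t : ℕ) :
    ∃ m N : ℕ, ∀ {α β : Type u} [Fintype β] (X : Finset α) (r : α → β → Prop), m ≤ #X →
      N ≤ Fintype.card β → (∀ x ∈ X, c * Fintype.card β ≤ cnt (r x)) →
      ∃ X' ⊆ X, #X' = t ∧ ∃ Y' : Finset β, #Y' = t ∧ ∀ x ∈ X', ∀ y ∈ Y', r x y := by
  rcases Nat.eq_zero_or_pos t with rfl | ht
  · exact ⟨0, 0, fun X r _ _ _ => ⟨∅, by simp, by simp, ∅, by simp⟩⟩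
  -- With `m ≥ 2t/c` the vertices having fewer than `t` neighbors in `X₀` account for at most half
  -- of the `m * c * n` pairs, so at least `c * n / 2` vertices are rich. `N` makes these at least
  -- `2 ^ m * t`, for a pigeonhole over the subsets of `X₀`.
  obtain ⟨m, hm⟩ := exists_nat_ge (2 * t / c)
  obtain ⟨N, hN⟩ := exists_nat_ge (2 ^ (m + 1) * t / c)
  refine ⟨m, N, fun {α β} _ X r hX hβ hr => ?_⟩
  obtain ⟨X₀, hX₀, hX₀c⟩ := exists_subset_card_eq hX
  rw [div_le_iff₀ hc] at hm hN
  set n := Fintype.card β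
  have hm0 : (0 : ℝ) < m := by
    have : (0 : ℝ) < t := by exact_mod_cast ht
    by_contra! h
    nlinarith
  set Y₁ : Finset β := {y | t ≤ #{x ∈ X₀ | r x y}} with hY₁
  have h1 : (m : ℝ) * (c * n) ≤ t * n + m * #Y₁ := by
    calc (m : ℝ) * (c * n) = ∑ x ∈ X₀, c * n := by rw [sum_const, hX₀c, nsmul_eq_mul]
      _ ≤ ∑ x ∈ X₀, (cnt (r x) : ℝ) := sum_le_sum fun x hx => hr x (hX₀ hx)
      _ = ∑ y, (#{x ∈ X₀ | r x y} : ℝ) := by exact_mod_cast sum_cnt_comm X₀ r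
      _ ≤ ∑ y : β, ((t : ℝ) + m * if y ∈ Y₁ then 1 else 0) := by
        refine sum_le_sum fun y _ => ?_
        by_cases hy : y ∈ Y₁
        · rw [if_pos hy, mul_one]
          have : #{x ∈ X₀ | r x y} ≤ m := hX₀c ▸ card_filter_le _ _
          have : (#{x ∈ X₀ | r x y} : ℝ) ≤ m := by exact_mod_cast this
          have : (0 : ℝ) ≤ t := by positivity
          linarith
        · rw [if_neg hy, mul_zero, add_zero]
          simp only [hY₁, mem_filter, mem_univ, true_and, not_le] at hy
          exact_mod_cast hy.le
      _ = t * n + m * #Y₁ := by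
        rw [sum_add_distrib, ← mul_sum, sum_const, card_univ, nsmul_eq_mul, mul_comm (n : ℝ)]
        simp [n]
  have h2 : c / 2 * n ≤ #Y₁ := by
    have : (m : ℝ) * (c / 2 * n) ≤ m * #Y₁ := by
      have : (2 * (t : ℝ)) * n ≤ (m * c) * n := by gcongr
      linarith
    exact le_of_mul_le_mul_left this hm0
  have h3 : #X₀.powerset * t ≤ #Y₁ := by
    rw [card_powerset, hX₀c]
    have : (N : ℝ) ≤ n := by exact_mod_cast hβ
    have : (N : ℝ) * c ≤ n * c := by gcongr
    have : (2 : ℝ) ^ m * t ≤ #Y₁ := by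
      rw [pow_succ] at hN
      linarith
    exact_mod_cast this
  obtain ⟨S, hS, hS'⟩ := exists_le_card_fiber_of_mul_le_card_of_maps_to
    (f := fun y => ({x ∈ X₀ | r x y} : Finset α))
    (fun y _ => mem_powerset.2 (filter_subset _ _)) ⟨∅, by simp⟩ h3
  obtain ⟨y, hy⟩ := card_pos.1 (ht.trans_le hS')
  simp only [hY₁, mem_filter, mem_univ, true_and] at hy
  obtain ⟨X', hX', hX'c⟩ := exists_subset_card_eq (hy.2 ▸ hy.1)
  obtain ⟨Y', hY', hY'c⟩ := exists_subset_card_eq hS'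
  refine ⟨X', fun x hx => hX₀ (mem_powerset.1 hS (hX' hx)), hX'c, Y', hY'c, fun x hx y hy => ?_⟩
  have h4 := hY' hy
  simp only [mem_filter] at h4
  have h5 := hX' hx
  rw [← h4.2] at h5
  exact (mem_filter.1 h5).2

/-- A complete bipartite graph with parts of size `t` in the neighborhood of some vertex. -/
def HasWheel {Ω : Type*} (G : SimpleGraph Ω) (t : ℕ) : Prop :=
  ∃ (v : Ω) (X Y : Finset Ω), #X = t ∧ #Y = t ∧ (∀ x ∈ X, G.Adj v x) ∧ (∀ y ∈ Y, G.Adj v y) ∧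
    ∀ x ∈ X, ∀ y ∈ Y, G.Adj x y

/-- A matching of size `t` and `t` common neighbors of its vertices. -/
def HasMatched {Ω : Type*} (G : SimpleGraph Ω) (t : ℕ) : Prop :=
  ∃ (M : Finset (Ω × Ω)) (Y : Finset Ω), #M = t ∧ #Y = t ∧ (∀ p ∈ M, G.Adj p.1 p.2) ∧
    (∀ p ∈ M, ∀ q ∈ M, p ≠ q → p.1 ≠ q.1 ∧ p.1 ≠ q.2 ∧ p.2 ≠ q.1 ∧ p.2 ≠ q.2) ∧
    ∀ p ∈ M, ∀ y ∈ Y, G.Adj p.1 y ∧ G.Adj p.2 y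

/-- If there are linearly many vertices in the neighborhood of `v` with linearly many neighbors in
this neighborhood, then there is a complete bipartite graph in the neighborhood. -/
theorem exists_hasWheel {c : ℝ} (hc : 0 < c) (t : ℕ) :
    ∃ N : ℕ, ∀ {Ω : Type u} [Fintype Ω] (G : SimpleGraph Ω) (v : Ω) (P : Ω → Prop),
      N ≤ Fintype.card Ω → c * Fintype.card Ω ≤ cnt P → (∀ x, P x → G.Adj v x) →
      (∀ x, P x → c * Fintype.card Ω ≤ cnt (fun y => G.Adj v y ∧ G.Adj x y)) → HasWheel G t := by
  obtain ⟨m, N, h⟩ := exists_complete_pair.{u} hc t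
  obtain ⟨N', hN'⟩ := exists_nat_ge (m / c)
  refine ⟨max N N', fun {Ω} _ G v P hn hP hv hx => ?_⟩
  have hm : m ≤ #({x | P x} : Finset Ω) := by
    rw [div_le_iff₀ hc] at hN'
    have : (N' : ℝ) ≤ Fintype.card Ω := by exact_mod_cast (le_max_right _ _).trans hn
    have : (N' : ℝ) * c ≤ Fintype.card Ω * c := by gcongr
    have : (m : ℝ) ≤ cnt P := by linarith
    exact_mod_cast this
  obtain ⟨X', hX', hX'c, Y', hY'c, hXY⟩ := h _
    (fun x y => G.Adj v y ∧ G.Adj x y) hm ((le_max_left _ _).trans hn)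
    (fun x h => hx x (by simpa using h))
  -- That `Y'` lies in the neighborhood of `v` is read off from the relation at some `x ∈ X'`, so
  -- `X'` must be nonempty.
  rcases Nat.eq_zero_or_pos t with rfl | ht
  · exact ⟨v, ∅, ∅, by simp⟩
  obtain ⟨x, hx0⟩ := card_pos.1 (hX'c ▸ ht)
  exact ⟨v, X', Y', hX'c, hY'c, fun x hx => hv x (by simpa using hX' hx),
    fun y hy => (hXY x hx0 y hy).1, fun x hx y hy => (hXY x hx y hy).2⟩

/-- The vertex `v` goes to the hub and the two color classes of `H` without `v` go to the two sides.
-/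
theorem SimpleGraph.isContained_of_hasWheel {V Ω : Type*} [Fintype V] {H : SimpleGraph V} {v : V}
    (hv : (H.induce {v}ᶜ).IsBipartite) {G : SimpleGraph Ω} (hG : HasWheel G (Fintype.card V)) :
    H.IsContained G := by
  obtain ⟨w, X, Y, hX, hY, hwX, hwY, hXY⟩ := hG
  obtain ⟨C⟩ := hv
  let e := Fintype.equivFin V
  let eX : V ≃ X := Fintype.equivOfCardEq (by simp [hX])
  let eY : V ≃ Y := Fintype.equivOfCardEq (by simp [hY])
  let c : V → Fin 2 := fun u => if h : u = v then 0 else C ⟨u, h⟩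
  have hc : ∀ a b, a ≠ v → b ≠ v → H.Adj a b → c a ≠ c b := by
    intro a b ha hb hab
    simp only [c, dif_neg ha, dif_neg hb]
    exact C.valid (v := ⟨a, ha⟩) (w := ⟨b, hb⟩) hab
  let f : V → Ω := fun u => if u = v then w else if c u = 0 then eX u else eY u
  have hf : ∀ u, (u = v ∧ f u = w) ∨ (u ≠ v ∧ c u = 0 ∧ f u = eX u) ∨
      (u ≠ v ∧ c u = 1 ∧ f u = eY u) := by
    intro u
    by_cases hu : u = v
    · exact Or.inl ⟨hu, by simp [f, hu]⟩
    · by_cases hu0 : c u = 0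
      · exact Or.inr (Or.inl ⟨hu, hu0, by simp [f, hu, hu0]⟩)
      · exact Or.inr (Or.inr ⟨hu, by omega, by simp [f, hu, hu0]⟩)
  refine ⟨⟨⟨f, fun {a b} hab => ?_⟩, fun a b hab => ?_⟩⟩
  · rcases hf a with ⟨ha, ha'⟩ | ⟨ha, ha0, ha'⟩ | ⟨ha, ha0, ha'⟩ <;>
    rcases hf b with ⟨hb, hb'⟩ | ⟨hb, hb0, hb'⟩ | ⟨hb, hb0, hb'⟩ <;> rw [ha', hb']
    · exact (hab.ne (ha.trans hb.symm)).elim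
    · exact hwX _ (eX b).2
    · exact hwY _ (eY b).2
    · exact (hwX _ (eX a).2).symm
    · exact (hc a b ha hb hab (ha0.trans hb0.symm)).elim
    · exact hXY _ (eX a).2 _ (eY b).2
    · exact (hwY _ (eY a).2).symm
    · exact (hXY _ (eX b).2 _ (eY a).2).symm
    · exact (hc a b ha hb hab (ha0.trans hb0.symm)).elim
  · change f a = f b at hab
    rcases hf a with ⟨ha, ha'⟩ | ⟨ha, ha0, ha'⟩ | ⟨ha, ha0, ha'⟩ <;>
    rcases hf b with ⟨hb, hb'⟩ | ⟨hb, hb0, hb'⟩ | ⟨hb, hb0, hb'⟩ <;> rw [ha', hb'] at hab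
    · exact ha.trans hb.symm
    · exact ((hwX _ (eX b).2).ne hab).elim
    · exact ((hwY _ (eY b).2).ne hab).elim
    · exact ((hwX _ (eX a).2).ne hab.symm).elim
    · exact eX.injective (Subtype.ext hab)
    · exact ((hXY _ (eX a).2 _ (eY b).2).ne hab).elim
    · exact ((hwY _ (eY a).2).ne hab.symm).elim
    · exact ((hXY _ (eX b).2 _ (eY a).2).ne hab.symm).elim
    · exact eY.injective (Subtype.ext hab)

theorem matchedCompleteBipartiteGraph_isContained_of_hasMatched {Ω : Type*} {t : ℕ}
    {G : SimpleGraph Ω} (hG : HasMatched G t) :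
    (matchedCompleteBipartiteGraph t t).IsContained G := by
  obtain ⟨M, Y, hM, hY, hM1, hM2, hMY⟩ := hG
  let eM : Fin t ≃ M := Fintype.equivOfCardEq (by simp [hM])
  let eY : Fin t ≃ Y := Fintype.equivOfCardEq (by simp [hY])
  let f : (Fin t × Bool) ⊕ Fin t → Ω :=
    Sum.elim (fun p => if p.2 then (eM p.1).1.2 else (eM p.1).1.1) (fun j => eY j)
  have hadj : ∀ i b j, G.Adj (f (Sum.inl (i, b))) (f (Sum.inr j)) := by
    intro i b j
    have := hMY _ (eM i).2 _ (eY j).2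
    cases b
    exacts [this.1, this.2]
  refine ⟨⟨⟨f, fun {a b} hab => ?_⟩, fun a b hab => ?_⟩⟩
  · rcases a with ⟨i, s⟩ | i <;> rcases b with ⟨j, s'⟩ | j
    · have : i = j ∧ s ≠ s' := by
        simp only [matchedCompleteBipartiteGraph, SimpleGraph.sup_adj,
          SimpleGraph.fromRel_adj] at hab
        rcases hab with hab | ⟨-, ⟨x, h1, h2⟩ | ⟨x, h1, h2⟩⟩
        · simp at hab
        · cases h1; cases h2; simp
        · cases h1; cases h2; simp
      obtain ⟨rfl, hbc⟩ := this
      have := hM1 _ (eM i).2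
      cases s <;> cases s'
      · exact (hbc rfl).elim
      · exact this
      · exact this.symm
      · exact (hbc rfl).elim
    · exact hadj _ _ _
    · exact (hadj _ _ _).symm
    · simp [matchedCompleteBipartiteGraph] at hab
  · change f a = f b at hab
    rcases a with ⟨i, s⟩ | i <;> rcases b with ⟨j, s'⟩ | j
    · by_cases hij : i = j
      · subst hij
        have := (hM1 _ (eM i).2).ne
        cases s <;> cases s'
        · rfl
        · exact (this hab).elim
        · exact (this hab.symm).elim
        · rfl
      · have := hM2 _ (eM i).2 _ (eM j).2
          (fun h => hij (eM.injective (Subtype.ext h)))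
        cases s <;> cases s'
        · exact (this.1 hab).elim
        · exact (this.2.1 hab).elim
        · exact (this.2.2.1 hab).elim
        · exact (this.2.2.2 hab).elim
    · exact ((hadj _ _ _).ne hab).elim
    · exact ((hadj _ _ _).ne hab.symm).elim
    · rw [eY.injective (Subtype.ext hab)]

/-- Greedy: if a matching of `T` edges cannot be extended, its at most `2T` vertices cover all
edges, and the degree sum is at most twice the sum over the cover, that is `4 * T * Δ`. -/
theorem exists_matching {Ω : Type*} [Fintype Ω] (F : SimpleGraph Ω) {Δ : ℕ}
    (hΔ : ∀ v, cnt (F.Adj v) ≤ Δ) (T : ℕ) (hT : 4 * T * Δ < ∑ v, cnt (F.Adj v)) :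
    ∃ M : Finset (Ω × Ω), #M = T ∧ (∀ p ∈ M, F.Adj p.1 p.2) ∧
      ∀ p ∈ M, ∀ q ∈ M, p ≠ q → p.1 ≠ q.1 ∧ p.1 ≠ q.2 ∧ p.2 ≠ q.1 ∧ p.2 ≠ q.2 := by
  induction T with
  | zero => exact ⟨∅, by simp⟩
  | succ T ih =>
    obtain ⟨M, hM, hM1, hM2⟩ := ih (lt_of_le_of_lt (by gcongr; omega) hT)
    let C : Finset Ω := M.image Prod.fst ∪ M.image Prod.snd
    have hC : #C ≤ 2 * T := by
      refine (card_union_le _ _).trans ?_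
      have h1 := card_image_le (s := M) (f := Prod.fst)
      have h2 := card_image_le (s := M) (f := Prod.snd)
      omega
    have : ∃ v w, v ∉ C ∧ w ∉ C ∧ F.Adj v w := by
      by_contra! h
      have h1 : ∑ v, cnt (F.Adj v) ≤ ∑ v ∈ C, 2 * cnt (F.Adj v) := by
        calc ∑ v, cnt (F.Adj v) = ∑ v ∈ C, cnt (F.Adj v) + ∑ v ∈ Cᶜ, cnt (F.Adj v) :=
              (sum_add_sum_compl C _).symm
          _ ≤ ∑ v ∈ C, cnt (F.Adj v) + ∑ v ∈ C, cnt (F.Adj v) := by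
            gcongr 1
            -- Edges leaving the complement of `C` all end in `C`, so they are counted by the
            -- degrees in `C`.
            rw [sum_cnt_comm, ← sum_add_sum_compl C]
            have : ∑ y ∈ Cᶜ, #{x ∈ Cᶜ | F.Adj x y} = 0 := by
              refine sum_eq_zero fun y hy => ?_
              rw [card_eq_zero, filter_eq_empty_iff]
              intro x hx
              exact h x y (by simpa using hx) (by simpa using hy)
            rw [this, add_zero]
            refine sum_le_sum fun y _ => card_le_card fun x hx => ?_
            simp only [mem_filter, mem_univ, true_and] at hx ⊢
            exact hx.2.symm
          _ = _ := by rw [← sum_add_distrib]; simp only [two_mul]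
      have h2 : ∑ v ∈ C, 2 * cnt (F.Adj v) ≤ #C * (2 * Δ) := by
        rw [← smul_eq_mul]
        exact sum_le_card_nsmul _ _ _ fun v _ => by have := hΔ v; omega
      have h3 : #C * (2 * Δ) ≤ 2 * T * (2 * Δ) := by gcongr
      nlinarith
    obtain ⟨v, w, hv, hw, hvw⟩ := this
    have hCm : ∀ p ∈ M, p.1 ∈ C ∧ p.2 ∈ C := fun p hp =>
      ⟨mem_union_left _ (mem_image_of_mem _ hp), mem_union_right _ (mem_image_of_mem _ hp)⟩
    have hne : ∀ p ∈ M, v ≠ p.1 ∧ v ≠ p.2 ∧ w ≠ p.1 ∧ w ≠ p.2 := fun p hp =>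
      ⟨fun h => hv (h ▸ (hCm p hp).1), fun h => hv (h ▸ (hCm p hp).2),
        fun h => hw (h ▸ (hCm p hp).1), fun h => hw (h ▸ (hCm p hp).2)⟩
    refine ⟨insert (v, w) M, ?_, ?_, ?_⟩
    · rw [card_insert_of_notMem fun h => hv (hCm _ h).1, hM]
    · intro p hp
      rcases mem_insert.1 hp with rfl | hp
      exacts [hvw, hM1 p hp]
    · intro p hp q hq hpq
      rcases mem_insert.1 hp with rfl | hp <;> rcases mem_insert.1 hq with rfl | hq
      · exact (hpq rfl).elim
      · exact hne q hq
      · have := hne p hp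
        exact ⟨this.1.symm, this.2.2.1.symm, this.2.1.symm, this.2.2.2.symm⟩
      · exact hM2 p hp q hq hpq

/-- A subgraph with linearly many edges, small degrees and many common neighbors of the ends of
each edge gives a matching with many common neighbors. -/
theorem exists_hasMatched (t : ℕ) :
    ∃ η : ℝ, 0 < η ∧ ∃ N : ℕ, ∀ {Ω : Type u} [Fintype Ω] (G F : SimpleGraph Ω), F ≤ G →
      N ≤ Fintype.card Ω → (∀ v, (cnt (F.Adj v) : ℝ) ≤ η * Fintype.card Ω) →
      (1 / 10 * Fintype.card Ω : ℝ) ≤ ∑ v, cnt (F.Adj v) →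
      (∀ u w, F.Adj u w → (1 / 10 * Fintype.card Ω : ℝ) ≤ cnt (fun y => G.Adj u y ∧ G.Adj w y)) →
      HasMatched G t := by
  obtain ⟨m, N, h⟩ := exists_complete_pair.{u} (c := 1 / 10) (by norm_num) t
  -- This bound on the degrees gives `4 * m * Δ ≤ n / 20`, strictly below the degree sum since `n ≥
  -- 1`.
  refine ⟨1 / (80 * (m + 1)), by positivity, max N 1, fun {Ω} _ G F hFG hn hF hs hc => ?_⟩
  have hn0 : (1 : ℝ) ≤ Fintype.card Ω := by exact_mod_cast (le_max_right _ _).trans hn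
  set n := Fintype.card Ω
  let Δ := ⌊(1 / (80 * (m + 1)) : ℝ) * n⌋₊
  have hΔ : (Δ : ℝ) ≤ (1 / (80 * (m + 1)) : ℝ) * n := Nat.floor_le (by positivity)
  obtain ⟨M, hM, hM1, hM2⟩ := exists_matching F (Δ := Δ) (fun v => Nat.le_floor (hF v)) m (by
    have h1 : (4 * m * Δ : ℝ) ≤ 4 * m * ((1 / (80 * (m + 1)) : ℝ) * n) := by gcongr
    have h2 : 4 * m * ((1 / (80 * (m + 1)) : ℝ) * n) ≤ 1 / 20 * n := by
      have : 4 * m * (1 / (80 * (m + 1)) : ℝ) ≤ 1 / 20 := by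
        rw [mul_one_div, div_le_iff₀ (by positivity)]
        linarith
      calc _ = 4 * m * (1 / (80 * (m + 1)) : ℝ) * n := by ring
        _ ≤ _ := by gcongr
    have h3 : (4 * m * Δ : ℝ) < ∑ v, cnt (F.Adj v) := by linarith
    exact_mod_cast h3)
  -- The matching edges themselves play the role of vertices on one side, related to the common
  -- neighbors of their ends.
  obtain ⟨X', hX', hX'c, Y', hY'c, hXY⟩ := h M (fun p y => G.Adj p.1 y ∧ G.Adj p.2 y) hM.ge
    ((le_max_left _ _).trans hn) (fun p hp => hc _ _ (hM1 p hp))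
  exact ⟨X', Y', hX'c, hY'c, fun p hp => hFG (hM1 p (hX' hp)),
    fun p hp q hq => hM2 p (hX' hp) q (hX' hq), hXY⟩

/-! ### Few triangles and triangle removal -/

theorem sum_ite_eq_cnt {R α : Type*} [AddCommMonoidWithOne R] [Fintype α] (P : α → Prop)
    [DecidablePred P] : ∑ x, (if P x then (1 : R) else 0) = cnt P := by
  rw [cnt_eq_card, sum_boole]

theorem card_cliqueFinset_three_le {Ω : Type*} [Fintype Ω] (G : SimpleGraph Ω) :
    #(G.cliqueFinset 3) ≤
      ∑ v, ∑ x, cnt (fun y => G.Adj v x ∧ G.Adj v y ∧ G.Adj x y) := by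
  have h1 : G.cliqueFinset 3 ⊆ ({p : Ω × Ω × Ω | G.Adj p.1 p.2.1 ∧ G.Adj p.1 p.2.2 ∧
      G.Adj p.2.1 p.2.2} : Finset _).image (fun p => {p.1, p.2.1, p.2.2}) := by
    intro s hs
    rw [SimpleGraph.mem_cliqueFinset_iff, SimpleGraph.is3Clique_iff] at hs
    obtain ⟨a, b, c, hab, hac, hbc, rfl⟩ := hs
    exact mem_image.2 ⟨(a, b, c), by simp [hab, hac, hbc], rfl⟩
  refine (card_le_card h1).trans (card_image_le.trans ?_)
  rw [card_filter, Fintype.sum_prod_type]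
  refine sum_le_sum fun v _ => ?_
  rw [Fintype.sum_prod_type]
  refine sum_le_sum fun x _ => ?_
  rw [sum_ite_eq_cnt]
  exact le_rfl

/-- At each `v`, at most `c * n` neighbors have `c * n` or more common neighbors with `v`. These
contribute at most `n` triangles each, all others at most `c * n`. -/
theorem card_cliqueFinset_three_le_of_not_hasWheel {c : ℝ} (hc : 0 < c) (t : ℕ) :
    ∃ N : ℕ, ∀ {Ω : Type u} [Fintype Ω] (G : SimpleGraph Ω), N ≤ Fintype.card Ω →
      ¬ HasWheel G t → (#(G.cliqueFinset 3) : ℝ) ≤ 2 * c * (Fintype.card Ω) ^ 3 := by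
  obtain ⟨N, hN⟩ := exists_hasWheel.{u} hc t
  refine ⟨N, fun {Ω} _ G hn hG => ?_⟩
  have h1 := card_cliqueFinset_three_le G
  set n := Fintype.card Ω
  have h2 : ∀ v, (∑ x, cnt (fun y => G.Adj v x ∧ G.Adj v y ∧ G.Adj x y) : ℝ) ≤ 2 * c * n ^ 2 := by
    intro v
    let P : Ω → Prop := fun x => G.Adj v x ∧ c * n ≤ cnt (fun y => G.Adj v y ∧ G.Adj x y)
    have hP : (cnt P : ℝ) ≤ c * n := by
      by_contra! h
      exact hG (hN G v P hn h.le (fun x hx => hx.1) fun x hx => hx.2)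
    calc (∑ x, cnt (fun y => G.Adj v x ∧ G.Adj v y ∧ G.Adj x y) : ℝ)
        ≤ ∑ x, ((if P x then 1 else 0) * n + c * n) := by
          refine sum_le_sum fun x _ => ?_
          have hcn : 0 ≤ c * n := by positivity
          by_cases hx : P x
          · rw [if_pos hx]
            have : (cnt (fun y => G.Adj v x ∧ G.Adj v y ∧ G.Adj x y) : ℝ) ≤ n := by
              exact_mod_cast cnt_le_card _
            linarith
          · rw [if_neg hx, zero_mul, zero_add]
            by_cases hvx : G.Adj v x
            · have h3 : ¬ c * n ≤ cnt (fun y => G.Adj v y ∧ G.Adj x y) := fun h => hx ⟨hvx, h⟩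
              simpa [hvx] using (not_le.1 h3).le
            · simpa [hvx, cnt_false] using hcn
      _ = cnt P * n + n * (c * n) := by
          rw [sum_add_distrib, ← sum_mul, sum_const, card_univ, nsmul_eq_mul, sum_ite_eq_cnt]
      _ ≤ c * n * n + n * (c * n) := by gcongr
      _ = 2 * c * n ^ 2 := by ring
  calc (#(G.cliqueFinset 3) : ℝ)
      ≤ ∑ v, ∑ x, (cnt (fun y => G.Adj v x ∧ G.Adj v y ∧ G.Adj x y) : ℝ) := by exact_mod_cast h1
    _ ≤ ∑ v : Ω, 2 * c * n ^ 2 := sum_le_sum fun v _ => h2 v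
    _ = 2 * c * n ^ 3 := by
      rw [sum_const, card_univ, nsmul_eq_mul]
      ring

theorem cnt_adj_eq_degree {Ω : Type*} [Fintype Ω] (G : SimpleGraph Ω) (v : Ω) :
    cnt (G.Adj v) = G.degree v := by
  rw [← SimpleGraph.card_neighborFinset_eq_degree, cnt]
  congr 1
  ext w
  simp

/-- A graph whose neighborhoods contain no large complete bipartite graphs can be made
triangle-free by removing few edges at almost all vertices. -/
theorem exists_cliqueFree_of_not_hasWheel {δ : ℝ} (hδ : 0 < δ) (t : ℕ) :
    ∃ N : ℕ, ∀ {Ω : Type u} [Fintype Ω] (G : SimpleGraph Ω), N ≤ Fintype.card Ω →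
      ¬ HasWheel G t → ∃ G' ≤ G, G'.CliqueFree 3 ∧
        (cnt (fun v => δ * Fintype.card Ω < cnt (fun w => G.Adj v w ∧ ¬ G'.Adj v w)) : ℝ) ≤
          δ * Fintype.card Ω := by
  -- Removing at most `δ² n² / 2` edges lowers the degree sum by at most `δ² n²`, so by Markov at
  -- most `δ n` vertices lose more than `δ n` edges.
  have hε : 0 < δ ^ 2 / 2 := by positivity
  have hβ := SimpleGraph.triangleRemovalBound_pos hε
  obtain ⟨N, hN⟩ := card_cliqueFinset_three_le_of_not_hasWheel.{u}
    (c := SimpleGraph.triangleRemovalBound (δ ^ 2 / 2) / 3) (by positivity) t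
  refine ⟨max N 1, fun {Ω} _ G hn hG => ?_⟩
  have h1 := hN G ((le_max_left _ _).trans hn) hG
  have hn0 : 0 < Fintype.card Ω := (le_max_right _ _).trans hn
  obtain ⟨G', hG', _, hE, hfree⟩ := SimpleGraph.triangle_removal (G := G) (ε := δ ^ 2 / 2) (by
    refine h1.trans_lt ?_
    have : 0 < SimpleGraph.triangleRemovalBound (δ ^ 2 / 2) * (Fintype.card Ω : ℝ) ^ 3 := by
      positivity
    linarith)
  refine ⟨G', hG', hfree, ?_⟩
  set n := Fintype.card Ω
  have hn0' : (0 : ℝ) < n := by exact_mod_cast hn0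
  set b : Ω → Prop := fun v => δ * n < cnt (fun w => G.Adj v w ∧ ¬ G'.Adj v w)
  have h2 : ∀ v, (cnt (fun w => G.Adj v w ∧ ¬ G'.Adj v w) : ℝ) = G.degree v - G'.degree v := by
    intro v
    rw [← cnt_adj_eq_degree, ← cnt_and_add_cnt_and_not (G.Adj v) (G'.Adj v)]
    have : cnt (fun w => G.Adj v w ∧ G'.Adj v w) = G'.degree v := by
      rw [← SimpleGraph.card_neighborFinset_eq_degree, cnt]
      congr 1
      ext w
      simpa using fun h => hG' h
    rw [this]
    push_cast
    ring
  have h3 : (∑ v, cnt (fun w => G.Adj v w ∧ ¬ G'.Adj v w) : ℝ) ≤ δ ^ 2 * n ^ 2 := by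
    have h4 : (∑ v, G.degree v : ℝ) = 2 * #G.edgeFinset := by
      exact_mod_cast G.sum_degrees_eq_twice_card_edges
    have h5 : (∑ v, G'.degree v : ℝ) = 2 * #G'.edgeFinset := by
      exact_mod_cast G'.sum_degrees_eq_twice_card_edges
    simp only [h2, sum_sub_distrib]
    rw [h4, h5]
    push_cast at hE
    linarith
  have h4 : (cnt b : ℝ) * (δ * n) ≤ δ ^ 2 * n ^ 2 := by
    refine le_trans ?_ h3
    rw [cnt, ← nsmul_eq_mul, ← sum_const]
    refine le_trans (sum_le_sum (g := fun v => (cnt (fun w => G.Adj v w ∧ ¬ G'.Adj v w) : ℝ))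
      fun v hv => ?_) (sum_le_univ_sum_of_nonneg fun v => by positivity)
    simp only [mem_filter, mem_univ, true_and] at hv
    exact hv.le
  have h5 : 0 < δ * n := by positivity
  exact le_of_mul_le_mul_right (h4.trans (by ring_nf; rfl)) h5

/-! ### Triangle-free graphs of large minimum degree -/

theorem exists_adj_adj_of_maximal_cliqueFree {W : Type*} {M : SimpleGraph W}
    (hM : Maximal (fun H : SimpleGraph W => H.CliqueFree 3) M) {x y : W} (hxy : x ≠ y)
    (h : ¬ M.Adj x y) : ∃ w, M.Adj x w ∧ M.Adj y w := by
  obtain ⟨s, hx, hy, h1, h2⟩ := SimpleGraph.exists_of_maximal_cliqueFree_not_adj (n := 2) hM hxy h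
  have h3 := h1.card_eq
  rw [card_insert_of_notMem hx] at h3
  obtain ⟨w, rfl⟩ := card_eq_one.1 (Nat.succ_injective h3)
  rw [mem_singleton] at hx hy
  exact ⟨w, h1.isClique (by simp) (by simp) hx, h2.isClique (by simp) (by simp) hy⟩

/-- In a triangle-free graph any vertex sees an independent set of a given pentagon; one that sees
two vertices mimics the pentagon vertex between them. -/
theorem cnt_le_two_of_pentagon_independent (a : Fin 5 → Prop) (h : ∀ i, a i → ¬ a (i + 1)) :
    cnt a ≤ 2 ∧ (cnt a ≤ 1 ∨ ∃ i, a (i - 1) ∧ a (i + 1)) := by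
  have key : ∀ f : Fin 5 → Bool, (∀ i, f i = true → ¬ f (i + 1) = true) →
      (#{i | f i = true} ≤ 2 ∧
        (#{i | f i = true} ≤ 1 ∨ ∃ i, f (i - 1) = true ∧ f (i + 1) = true)) := by
    decide
  have := key (fun i => decide (a i)) (by simpa using h)
  simp only [decide_eq_true_eq] at this
  rw [cnt]
  convert this

/-- A triangle-free graph of minimum degree at least `d` is bipartite or, apart from few vertices,
homomorphic to a pentagon. -/
theorem bipartite_or_pentagon_of_cliqueFree {W : Type*} [Fintype W] {G : SimpleGraph W}
    (hG : G.CliqueFree 3) {d : ℕ} (hd : ∀ v, d ≤ cnt (G.Adj v)) :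
    (∃ p : W → Bool, ∀ u v, G.Adj u v → p u ≠ p v) ∨
    ∃ p : W → Option (Fin 5), cnt (fun v => p v = none) + 5 * d ≤ 2 * Fintype.card W ∧
      (∀ u v i j, G.Adj u v → p u = some i → p v = some j → j = i + 1 ∨ i = j + 1) ∧
      ∀ i, ∃ v, p v = some i := by
  obtain ⟨M, hGM, hM⟩ := Finite.exists_le_maximal (p := fun H : SimpleGraph W => H.CliqueFree 3) hG
  have htri : ∀ a b c, M.Adj a b → M.Adj a c → M.Adj b c → False := fun a b c hab hac hbc =>
    hM.prop {a, b, c} (SimpleGraph.is3Clique_triple_iff.2 ⟨hab, hac, hbc⟩)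
  -- If non-adjacency is transitive, the maximal graph `M` is complete multipartite with at most two
  -- parts. Otherwise `x ≁ y ≁ z` with `x ~ z`, and by maximality common neighbors of `x, y` and of
  -- `y, z` complete a pentagon.
  by_cases htr : ∀ x y z, M.Adj x z → ¬ M.Adj x y → M.Adj y z
  · left
    rcases isEmpty_or_nonempty W with hW | ⟨⟨x⟩⟩
    · exact ⟨fun _ => false, fun u => hW.elim u⟩
    · refine ⟨fun u => decide (M.Adj x u), fun u v huv h => ?_⟩
      have huv := hGM huv
      by_cases hu : M.Adj x u
      · by_cases hv : M.Adj x v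
        · exact htri x u v hu hv huv
        · simp [hu, hv] at h
      · have := htr u x v huv (fun h' => hu h'.symm)
        simp [hu, this] at h
  right
  push Not at htr
  obtain ⟨x, y, z, hxz, hxy, hyz⟩ := htr
  obtain ⟨w, hxw, hyw⟩ := exists_adj_adj_of_maximal_cliqueFree hM
    (by rintro rfl; exact hyz hxz) hxy
  obtain ⟨w', hyw', hzw'⟩ := exists_adj_adj_of_maximal_cliqueFree hM
    (by rintro rfl; exact hxy hxz) hyz
  obtain ⟨c, hc⟩ : ∃ c : Fin 5 → W, ∀ i, M.Adj (c i) (c (i + 1)) := by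
    refine ⟨![x, w, y, w', z], fun i => ?_⟩
    fin_cases i
    exacts [hxw, hyw.symm, hyw', hzw'.symm, hxz.symm]
  have hind : ∀ u i, M.Adj u (c i) → ¬ M.Adj u (c (i + 1)) := fun u i h1 h2 =>
    htri u _ _ h1 h2 (hc i)
  let Q : W → Fin 5 → Prop := fun u i => M.Adj u (c (i - 1)) ∧ M.Adj u (c (i + 1))
  let p : W → Option (Fin 5) := fun u => if h : ∃ i, Q u i then some h.choose else none
  have hp : ∀ u i, p u = some i → Q u i := by
    intro u i h
    by_cases hu : ∃ i, Q u i
    · simp only [p, dif_pos hu, Option.some.injEq] at h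
      exact h ▸ hu.choose_spec
    · simp [p, dif_neg hu] at h
  have hp' : ∀ u, p u = none → ¬ ∃ i, Q u i := by
    intro u h hu
    simp [p, dif_pos hu] at h
  refine ⟨p, ?_, ?_, ?_⟩
  · have h1 : ∑ i : Fin 5, d ≤ ∑ i, cnt (M.Adj (c i)) :=
      sum_le_sum fun i _ => (hd (c i)).trans (cnt_mono fun x h => hGM h)
    have h2 : ∑ i, cnt (M.Adj (c i)) = ∑ u, cnt (fun i => M.Adj u (c i)) := by
      rw [sum_cnt_comm]
      refine sum_congr rfl fun u _ => ?_
      rw [cnt]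
      congr 1
      ext i
      simp [M.adj_comm]
    -- Double counting edges into the pentagon: every vertex sends at most two, an unclassified one
    -- at most one.
    have h3 : ∑ u, cnt (fun i => M.Adj u (c i)) + ∑ u, (if p u = none then 1 else 0) ≤
        ∑ u : W, 2 := by
      rw [← sum_add_distrib]
      refine sum_le_sum fun u _ => ?_
      obtain ⟨h3, h4⟩ := cnt_le_two_of_pentagon_independent _ (hind u)
      split_ifs with hu
      · have := hp' u hu
        have := h4.resolve_right this
        omega
      · omega
    rw [sum_ite_eq_cnt, Nat.cast_id] at h3
    simp only [sum_const, card_univ, Fintype.card_fin, smul_eq_mul] at h1 h3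
    omega
  · intro u v i j huv hu hv
    obtain ⟨hu1, hu2⟩ := hp u i hu
    obtain ⟨hv1, hv2⟩ := hp v j hv
    have huv := hGM huv
    -- Two classes not adjacent in the pentagon share a pentagon neighbor, which would form a
    -- triangle with `u` and `v`.
    have key : ∀ i j : Fin 5, (j = i + 1 ∨ i = j + 1) ∨ i - 1 = j - 1 ∨ i - 1 = j + 1 ∨
      i + 1 = j - 1 ∨ i + 1 = j + 1 := by decide
    rcases key i j with h | h | h | h | h
    · exact h
    · rw [h] at hu1
      exact (htri _ _ _ huv hu1 hv1).elim
    · rw [h] at hu1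
      exact (htri _ _ _ huv hu1 hv2).elim
    · rw [h] at hu2
      exact (htri _ _ _ huv hu2 hv1).elim
    · rw [h] at hu2
      exact (htri _ _ _ huv hu2 hv2).elim
  · intro i
    refine ⟨c i, ?_⟩
    have h1 : M.Adj (c i) (c (i - 1)) := by
      have := (hc (i - 1)).symm
      rwa [sub_add_cancel] at this
    have h2 := hc i
    rcases h : p (c i) with _ | k
    · exact (hp' _ h ⟨i, h1, h2⟩).elim
    · obtain ⟨h3, h4⟩ := hp _ _ h
      have key : ∀ i k : Fin 5, k = i ∨ k - 1 = (i - 1) + 1 ∨ (i - 1) = k - 1 + 1 ∨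
        k + 1 = (i - 1) + 1 ∨ i - 1 = k + 1 + 1 ∨ k - 1 = (i + 1) + 1 ∨ (i + 1) = k - 1 + 1 ∨
        k + 1 = (i + 1) + 1 ∨ i + 1 = k + 1 + 1 := by decide
      rcases key i k with h5 | h5 | h5 | h5 | h5 | h5 | h5 | h5 | h5
      · rw [h5]
      · exact (hind _ _ h1 (h5 ▸ h3)).elim
      · exact (hind _ _ h3 (h5 ▸ h1)).elim
      · exact (hind _ _ h1 (h5 ▸ h4)).elim
      · exact (hind _ _ h4 (h5 ▸ h1)).elim
      · exact (hind _ _ h2 (h5 ▸ h3)).elim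
      · exact (hind _ _ h3 (h5 ▸ h2)).elim
      · exact (hind _ _ h2 (h5 ▸ h4)).elim
      · exact (hind _ _ h4 (h5 ▸ h2)).elim

/-- After triangle removal, the structure theorem applies to the vertices that lost few edges. At a
classified vertex, an edge of `G` to a classified vertex that violates the pattern must be a removed
one. The value `none` marks unclassified vertices. -/
theorem exists_almost_bipartite_or_pentagon {δ : ℝ} (hδ : 0 < δ) (t : ℕ) :
    ∃ N : ℕ, ∀ {Ω : Type u} [Fintype Ω] (G : SimpleGraph Ω) (k : ℕ), N ≤ Fintype.card Ω →
      ¬ HasWheel G t → (∀ v, cnt (G.Adj v) = k) → 2 * Fintype.card Ω < 5 * k →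
      (∃ p : Ω → Option Bool, (cnt (fun v => p v = none) : ℝ) ≤ δ * Fintype.card Ω ∧
        ∀ v b, p v = some b → (cnt (fun w => G.Adj v w ∧ p w = some b) : ℝ) ≤
          δ * Fintype.card Ω) ∨
      (∃ p : Ω → Option (Fin 5), (cnt (fun v => p v = none) : ℝ) ≤ 11 * δ * Fintype.card Ω ∧
        (∀ v i, p v = some i →
          (cnt (fun w => G.Adj v w ∧ ∃ j, p w = some j ∧ ¬ (j = i + 1 ∨ i = j + 1)) : ℝ) ≤
            δ * Fintype.card Ω) ∧
        ∀ i, ∃ v, p v = some i) := by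
  obtain ⟨N, hN⟩ := exists_cliqueFree_of_not_hasWheel.{u} hδ t
  refine ⟨N, fun {Ω} _ G k hn hG hk hkn => ?_⟩
  obtain ⟨G', hG', hfree, hb⟩ := hN G hn hG
  set n := Fintype.card Ω
  set b : Ω → Prop := fun v => δ * n < cnt (fun w => G.Adj v w ∧ ¬ G'.Adj v w)
  let S := {v // ¬ b v}
  let e := ⌊δ * n⌋₊
  have he : (e : ℝ) ≤ δ * n := Nat.floor_le (by positivity)
  have hbe : cnt b ≤ e := Nat.le_floor hb
  have hS : ∀ q : Ω → Prop, cnt q ≤ cnt (fun v : S => q v.1) + e := by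
    intro q
    have h1 : cnt (fun v : S => q v.1) = cnt (fun v => q v ∧ ¬ b v) := by
      refine le_antisymm (cnt_le_of_injective Subtype.val Subtype.val_injective
        fun x h => ⟨h, x.2⟩) ?_
      rw [cnt, cnt]
      refine card_le_card_of_surjOn Subtype.val fun x hx => ?_
      simp only [coe_filter, mem_univ, true_and, Set.mem_ofPred_eq] at hx
      exact ⟨⟨x, hx.2⟩, by simpa using hx.1, rfl⟩
    rw [h1]
    calc cnt q ≤ cnt (fun v => q v ∧ ¬ b v) + cnt b := cnt_le_add fun x => by tauto
      _ ≤ _ := by gcongr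
  have hlost : ∀ v, ¬ b v → cnt (fun w => G.Adj v w ∧ ¬ G'.Adj v w) ≤ e := fun v hv =>
    Nat.le_floor (not_lt.1 hv)
  let G₂ : SimpleGraph S := G'.comap Subtype.val
  have hfree₂ : G₂.CliqueFree 3 := hfree.comap ⟨(SimpleGraph.Embedding.comap
    ⟨Subtype.val, Subtype.val_injective⟩ G').toCopy⟩
  -- At most `e` edges are lost in the removal and at most `e` more to vertices outside `S`.
  have hd : ∀ v : S, k - 2 * e ≤ cnt (G₂.Adj v) := by
    intro v
    have h1 : cnt (G'.Adj v.1) ≤ cnt (G₂.Adj v) + e := hS (G'.Adj v.1)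
    have h2 := hlost v.1 v.2
    have h3 := hk v.1
    have h4 : cnt (G.Adj v.1) ≤ cnt (G'.Adj v.1) +
      cnt (fun w => G.Adj v.1 w ∧ ¬ G'.Adj v.1 w) := cnt_le_add fun x => by tauto
    omega
  have hSn : Fintype.card S ≤ n := Fintype.card_subtype_le _
  rcases bipartite_or_pentagon_of_cliqueFree hfree₂ hd with ⟨p, hp⟩ | ⟨p, hp1, hp2, hp3⟩
  · left
    refine ⟨fun v => if h : ¬ b v then some (p ⟨v, h⟩) else none, ?_, ?_⟩
    · refine le_trans ?_ hb
      exact_mod_cast cnt_mono fun v hv => by by_contra h; simp [h] at hv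
    · intro v i hv
      by_cases hbv : b v
      · simp [hbv] at hv
      refine le_trans ?_ (not_lt.1 hbv)
      have : ∀ w, (G.Adj v w ∧ (if h : ¬ b w then some (p ⟨w, h⟩) else none) = some i) →
          (G.Adj v w ∧ ¬ G'.Adj v w) := by
        rintro w ⟨h1, h2⟩
        refine ⟨h1, fun h3 => ?_⟩
        by_cases hbw : b w
        · simp [hbw] at h2
        simp only [hbw, hbv, not_false_eq_true, dite_true, Option.some.injEq] at h2 hv
        exact hp ⟨v, hbv⟩ ⟨w, hbw⟩ h3 (hv.trans h2.symm)
      exact_mod_cast cnt_mono this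
  · right
    refine ⟨fun v => if h : ¬ b v then p ⟨v, h⟩ else none, ?_, ?_, ?_⟩
    · have h1 := hS (fun v => (if h : ¬ b v then p ⟨v, h⟩ else none) = none)
      have h2 : cnt (fun v : S => (if h : ¬ b v.1 then p ⟨v.1, h⟩ else none) = none) =
          cnt (fun v => p v = none) := cnt_congr fun v => by
        rw [dif_pos v.2]
      rw [h2] at h1
      -- The degree loss `2 * e` costs `5 * 2e` unclassified vertices in `S`; the `e` vertices
      -- outside `S` make it `11 * e`.
      have h3 : cnt (fun v => (if h : ¬ b v then p ⟨v, h⟩ else none) = none) ≤ 11 * e := by omega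
      have h4 : (cnt (fun v => (if h : ¬ b v then p ⟨v, h⟩ else none) = none) : ℝ) ≤ 11 * e := by
        exact_mod_cast h3
      linarith
    · intro v i hv
      by_cases hbv : b v
      · simp [hbv] at hv
      refine le_trans ?_ (not_lt.1 hbv)
      have : ∀ w, (G.Adj v w ∧ ∃ j, (if h : ¬ b w then p ⟨w, h⟩ else none) = some j ∧
          ¬ (j = i + 1 ∨ i = j + 1)) → (G.Adj v w ∧ ¬ G'.Adj v w) := by
        rintro w ⟨h1, j, h2, h4⟩
        refine ⟨h1, fun h3 => ?_⟩
        by_cases hbw : b w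
        · simp [hbw] at h2
        rw [dif_pos hbw] at h2
        exact h4 (hp2 ⟨v, hbv⟩ ⟨w, hbw⟩ i j h3 ((dif_pos hbv).symm.trans hv) h2)
      exact_mod_cast cnt_mono this
    · intro i
      obtain ⟨v, hv⟩ := hp3 i
      exact ⟨v.1, (dif_pos v.2).trans hv⟩

/-! ### The nearly bipartite case -/

theorem cnt_add_le_of_imp {Ω : Type*} [Fintype Ω] {q r s : Ω → Prop} (hq : ∀ x, q x → s x)
    (hr : ∀ x, r x → s x) : cnt q + cnt r ≤ cnt (fun x => q x ∧ r x) + cnt s := by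
  have h1 := cnt_and_add_cnt_and_not q r
  have h2 : cnt r + cnt (fun x => q x ∧ ¬ r x) ≤ cnt s := by
    rw [← cnt_and_add_cnt_and_not s r]
    exact add_le_add (cnt_mono fun x h => ⟨hr x h, h⟩) (cnt_mono fun x h => ⟨hq x h.1, h.2⟩)
  omega

theorem sum_cnt_fiber {Ω ι : Type*} [Fintype Ω] [Fintype ι] (c : Ω → ι) :
    ∑ i, cnt (fun v => c v = i) = Fintype.card Ω := by
  simp only [cnt]
  exact (card_eq_sum_card_fiberwise (fun _ _ => by simp)).symm

theorem cnt_le_sum {Ω ι : Type*} [Fintype Ω] [Fintype ι] {q : Ω → Prop} {r : ι → Ω → Prop}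
    (h : ∀ x, q x → ∃ i, r i x) : cnt q ≤ ∑ i, cnt (r i) := by
  refine le_trans (card_le_card ?_) (card_biUnion_le (s := univ) (t := fun i => {x | r i x}))
  intro x
  simpa using h x

theorem cnt_adj_le_of_option_bool {Ω : Type*} [Fintype Ω] (G : SimpleGraph Ω)
    (p : Ω → Option Bool) (v : Ω) (b : Bool) :
    cnt (G.Adj v) ≤ cnt (fun w => G.Adj v w ∧ p w = some (!b)) +
      (cnt (fun w => G.Adj v w ∧ p w = some b) + cnt (fun w => p w = none)) := by
  refine (cnt_le_add (r := fun w => (G.Adj v w ∧ p w = some b) ∨ p w = none)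
    fun w hw => ?_).trans (Nat.add_le_add_left (cnt_le_add fun w hw => hw) _)
  rcases h : p w with _ | b'
  · simp
  · cases b <;> cases b' <;> simp [hw]

theorem exists_hasMatched_of_almost_bipartite (t : ℕ) :
    ∃ δ₀ : ℝ, 0 < δ₀ ∧ ∀ δ, 0 < δ → δ ≤ δ₀ → ∃ N : ℕ, ∀ {Ω : Type u} [Fintype Ω]
      (G : SimpleGraph Ω) (k : ℕ), N ≤ Fintype.card Ω → Odd (Fintype.card Ω) →
      ¬ HasWheel G t → (∀ v, cnt (G.Adj v) = k) → 2 * Fintype.card Ω < 5 * k →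
      ∀ p : Ω → Option Bool, (cnt (fun v => p v = none) : ℝ) ≤ δ * Fintype.card Ω →
        (∀ v b, p v = some b → (cnt (fun w => G.Adj v w ∧ p w = some b) : ℝ) ≤
          δ * Fintype.card Ω) → HasMatched G t := by
  obtain ⟨η₀, hη₀, N₁, hN₁⟩ := exists_hasMatched.{u} t
  obtain ⟨η, hη, hηη₀, hη100⟩ : ∃ η : ℝ, 0 < η ∧ η ≤ η₀ ∧ η ≤ 1 / 100 :=
    ⟨min η₀ (1 / 100), by positivity, min_le_left _ _, min_le_right _ _⟩
  obtain ⟨N₂, hN₂⟩ := exists_hasWheel.{u} (c := η / 2) (by positivity) t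
  refine ⟨η / 4, by positivity, fun δ hδ hδη => ⟨max N₁ N₂, ?_⟩⟩
  intro Ω _ G k hn hodd hW hk hkn p hp0 hp1
  have hn1 := (le_max_left _ _).trans hn
  have hn2 := (le_max_right _ _).trans hn
  set n := Fintype.card Ω
  have hkn' : (2 * n : ℝ) ≤ 5 * k := by exact_mod_cast hkn.le
  have hn0 : (0 : ℝ) ≤ n := by positivity
  have hδn : δ * n ≤ η / 4 * n := by gcongr
  have hηn : η * n ≤ 1 / 100 * n := by gcongr
  have hηn0 : 0 ≤ η * n := by positivity
  have step1 : ∀ v, ∃ b, (cnt (fun w => G.Adj v w ∧ p w = some b) : ℝ) ≤ η / 2 * n ∧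
      ∀ b', p v = some b' → b = b' := by
    intro v
    rcases hv : p v with _ | b
    swap
    · exact ⟨b, (hp1 v b hv).trans (by linarith), by simp⟩
    by_contra! hcon
    have hcon : ∀ b, η / 2 * n < cnt (fun w => G.Adj v w ∧ p w = some b) := by
      intro b
      by_contra! h
      obtain ⟨b', h', -⟩ := hcon b h
      simp at h'
    -- A neighbor `x` of `v` in class `b` sends at least `k - 2δn` edges to the other class; if
    -- these overlap the neighbors of `v` there in `n / 20` vertices, a wheel arises. Failure for
    -- both `b` sums to roughly `3k < 11n / 10`, against `3k ≥ 6n / 5`.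
    have key : ∀ b, (cnt (fun w => p w = some (!b)) : ℝ) + 1 / 20 * n ≤
        k - 2 * δ * n + cnt (fun w => G.Adj v w ∧ p w = some (!b)) → False := by
      intro b hb
      refine hW (hN₂ G v (fun x => G.Adj v x ∧ p x = some b) hn2 (hcon b).le (fun x hx => hx.1) ?_)
      rintro x ⟨-, hx⟩
      have h1 : cnt (G.Adj x) ≤ cnt (fun w => G.Adj x w ∧ p w = some (!b)) +
          (cnt (fun w => G.Adj x w ∧ p w = some b) + cnt (fun w => p w = none)) :=
        cnt_adj_le_of_option_bool G p x b
      have h2 : (cnt (fun w => G.Adj x w ∧ p w = some b) : ℝ) ≤ δ * n := hp1 x b hx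
      have h3 := cnt_add_le_of_imp (q := fun w => G.Adj x w ∧ p w = some (!b))
        (r := fun w => G.Adj v w ∧ p w = some (!b)) (s := fun w => p w = some (!b))
        (fun x h => h.2) (fun x h => h.2)
      have h4 : cnt (fun w => (G.Adj x w ∧ p w = some (!b)) ∧ G.Adj v w ∧ p w = some (!b)) ≤
        cnt (fun w => G.Adj v w ∧ G.Adj x w) := cnt_mono fun w h => ⟨h.2.1, h.1.1⟩
      rw [hk x] at h1
      have h5 : (k : ℝ) ≤ cnt (fun w => G.Adj x w ∧ p w = some (!b)) +
          (cnt (fun w => G.Adj x w ∧ p w = some b) + cnt (fun w => p w = none)) := by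
        exact_mod_cast h1
      have h6 : (cnt (fun w => G.Adj x w ∧ p w = some (!b)) +
        cnt (fun w => G.Adj v w ∧ p w = some (!b)) : ℝ) ≤ cnt (fun w => G.Adj v w ∧ G.Adj x w) +
          cnt (fun w => p w = some (!b)) := by
        exact_mod_cast h3.trans (by gcongr)
      linarith
    have h1 : cnt (G.Adj v) ≤ cnt (fun w => G.Adj v w ∧ p w = some true) +
          (cnt (fun w => G.Adj v w ∧ p w = some false) + cnt (fun w => p w = none)) :=
      cnt_adj_le_of_option_bool G p v false
    rw [hk v] at h1
    have h2 : (k : ℝ) ≤ cnt (fun w => G.Adj v w ∧ p w = some true) +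
          (cnt (fun w => G.Adj v w ∧ p w = some false) + cnt (fun w => p w = none)) := by
      exact_mod_cast h1
    have h3 := sum_cnt_fiber p
    rw [Fintype.sum_option, Fintype.sum_bool] at h3
    have h4 : (cnt (fun w => p w = none) : ℝ) +
        (cnt (fun w => p w = some true) + cnt (fun w => p w = some false)) = n := by
      exact_mod_cast h3
    have h5 := key true
    have h6 := key false
    simp only [Bool.not_true, Bool.not_false] at h5 h6
    have h5 := not_le.1 h5
    have h6 := not_le.1 h6
    have h7 : (0 : ℝ) ≤ cnt (fun w => p w = none) := by positivity
    linarith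
  choose c hc hcp using step1
  have hcn : ∀ v, (cnt (fun w => G.Adj v w ∧ c w = c v) : ℝ) ≤ η * n := by
    intro v
    have h1 : cnt (fun w => G.Adj v w ∧ c w = c v) ≤ cnt (fun w => G.Adj v w ∧ p w = some (c v)) +
        cnt (fun w => p w = none) := by
      refine cnt_le_add fun w hw => ?_
      rcases h : p w with _ | b
      · exact Or.inr rfl
      · exact Or.inl ⟨hw.1, by rw [← hw.2, hcp w b h]⟩
    have h2 : (cnt (fun w => G.Adj v w ∧ c w = c v) : ℝ) ≤
        cnt (fun w => G.Adj v w ∧ p w = some (c v)) + cnt (fun w => p w = none) := by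
      exact_mod_cast h1
    have h3 := hc v
    linarith
  have hAB := sum_cnt_fiber c
  rw [Fintype.sum_bool] at hAB
  -- Since `n` is odd, one class is strictly larger. Counting edges across from both sides then
  -- leaves a degree sum of at least `k` inside it.
  obtain ⟨b, hb⟩ : ∃ b, cnt (fun v => c v = !b) < cnt (fun v => c v = b) := by
    rcases lt_trichotomy (cnt (fun v => c v = true)) (cnt (fun v => c v = false)) with h | h | h
    · exact ⟨false, h⟩
    · rw [h] at hAB
      obtain ⟨m, hm⟩ := hodd
      omega
    · exact ⟨true, h⟩
  have hAB' : cnt (fun v => c v = b) + cnt (fun v => c v = !b) = n := by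
    cases b
    · rw [add_comm]; exact hAB
    · exact hAB
  let F : SimpleGraph Ω :=
    { Adj := fun u w => G.Adj u w ∧ c u = b ∧ c w = b
      symm := ⟨fun u w h => ⟨h.1.symm, h.2.2, h.2.1⟩⟩
      loopless := ⟨fun u h => h.1.ne rfl⟩ }
  have hbn : ∀ w, c w = b ∨ c w = !b := fun w => by cases c w <;> cases b <;> simp
  have hout : ∀ u, cnt (fun w => G.Adj u w ∧ c w = b) + cnt (fun w => G.Adj u w ∧ c w = !b) =
      k := by
    intro u
    rw [← hk u]
    refine (cnt_eq_add (fun w => ?_) fun w h1 h2 => ?_).symm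
    · have := hbn w
      tauto
    · have := h1.2.symm.trans h2.2
      cases b <;> simp at this
  refine hN₁ G F (fun u w h => h.1) hn1 (fun v => ?_) ?_ ?_
  · have h1 : cnt (F.Adj v) ≤ cnt (fun w => G.Adj v w ∧ c w = c v) :=
      cnt_mono fun w h => ⟨h.1, h.2.2.trans h.2.1.symm⟩
    have h2 : (cnt (F.Adj v) : ℝ) ≤ cnt (fun w => G.Adj v w ∧ c w = c v) := by exact_mod_cast h1
    have h3 : η * n ≤ η₀ * n := by gcongr
    exact h2.trans ((hcn v).trans h3)
  · have h1 : ∑ u with c u = b, k = ∑ u with c u = b, cnt (fun w => G.Adj u w ∧ c w = b) +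
        ∑ u with c u = b, cnt (fun w => G.Adj u w ∧ c w = !b) := by
      rw [← sum_add_distrib]
      exact sum_congr rfl fun u _ => (hout u).symm
    have h2 : ∑ u with c u = b, cnt (fun w => G.Adj u w ∧ c w = !b) ≤
        ∑ u with c u = !b, k := by
      rw [sum_cnt_comm, sum_filter]
      refine sum_le_sum fun w _ => ?_
      split_ifs with hw
      · rw [← hk w, cnt]
        refine card_le_card fun u hu => ?_
        simp only [mem_filter, mem_univ, true_and] at hu ⊢
        exact hu.2.1.symm
      · simp [hw]
    have h3 : ∑ u with c u = b, cnt (fun w => G.Adj u w ∧ c w = b) ≤ ∑ v, cnt (F.Adj v) := by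
      rw [sum_filter]
      refine sum_le_sum fun u _ => ?_
      split_ifs with hu
      · exact cnt_mono fun w h => ⟨h.1, hu, h.2⟩
      · exact Nat.zero_le _
    simp only [sum_const, smul_eq_mul] at h1 h2
    rw [← cnt_eq_card] at h1 h2
    have h4 : (cnt (fun v => c v = !b) + 1) * k ≤ cnt (fun v => c v = b) * k :=
      Nat.mul_le_mul_right _ hb
    have h5 : k ≤ ∑ v, cnt (F.Adj v) := by
      rw [add_mul] at h4
      omega
    have h6 : (k : ℝ) ≤ ∑ v, cnt (F.Adj v) := by exact_mod_cast h5
    refine le_trans ?_ h6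
    linarith
  · rintro u w ⟨-, hu, hw⟩
    -- Both ends send at least `k - ηn` edges to the smaller class, which has at most `n / 2`
    -- vertices.
    have h1 := cnt_add_le_of_imp (q := fun y => G.Adj u y ∧ c y = !b)
      (r := fun y => G.Adj w y ∧ c y = !b) (s := fun y => c y = !b)
      (fun x h => h.2) (fun x h => h.2)
    have h2 : cnt (fun y => (G.Adj u y ∧ c y = !b) ∧ G.Adj w y ∧ c y = !b) ≤
      cnt (fun y => G.Adj u y ∧ G.Adj w y) := cnt_mono fun y h => ⟨h.1.1, h.2.1⟩
    have h3 := hout u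
    have h4 := hout w
    have h5 := hcn u
    have h6 := hcn w
    rw [hu] at h5
    rw [hw] at h6
    have h7 : (2 * k : ℝ) + 2 * k ≤ 2 * cnt (fun y => G.Adj u y ∧ G.Adj w y) + n +
        2 * cnt (fun w => G.Adj u w ∧ c w = b) + 2 * cnt (fun y => G.Adj w y ∧ c y = b) := by
      norm_cast
      omega
    linarith

/-! ### The nearly pentagonal case -/

theorem sum_fin_five_shift (f : Fin 5 → ℕ) (i : Fin 5) :
    f i + f (i + 1) + f (i + 2) + f (i + 3) + f (i + 4) = ∑ j, f j := by
  rw [← Equiv.sum_comp (Equiv.addLeft i), Fin.sum_univ_five]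
  simp

theorem pentagon_adj_iff (i j : Fin 5) : (j = i + 1 ∨ i = j + 1) ↔ (j = i + 1 ∨ j = i + 4) := by
  revert i j
  decide

/-- This finds the class of an exceptional vertex from the set of classes in which it has many
neighbors. -/
theorem exists_of_pentagon_independent (a : Fin 5 → Prop) (h : ∀ i, a i → ¬ a (i + 1)) :
    ∃ j, ∀ l, a l → (l = j + 1 ∨ j = l + 1) := by
  have key : ∀ f : Fin 5 → Bool, (∀ i, f i = true → ¬ f (i + 1) = true) →
      ∃ j, ∀ l, f l = true → (l = j + 1 ∨ j = l + 1) := by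
    decide
  simpa using key (fun i => decide (a i)) (by simpa using h)

/-- The sizes of the classes of an almost pentagon-homomorphism are almost equal. -/
theorem pentagon_class_sizes {Ω : Type*} [Fintype Ω] {G : SimpleGraph Ω} {k e₁ e₂ : ℕ}
    (hk : ∀ v, cnt (G.Adj v) = k) {p : Ω → Option (Fin 5)}
    (hp0 : cnt (fun v => p v = none) ≤ e₁)
    (hp1 : ∀ v i, p v = some i →
      cnt (fun w => G.Adj v w ∧ ∃ j, p w = some j ∧ ¬ (j = i + 1 ∨ i = j + 1)) ≤ e₂)
    (hp2 : ∀ i, ∃ v, p v = some i) :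
    (∀ v i, p v = some i → k ≤ cnt (fun w => G.Adj v w ∧ p w = some (i + 1)) +
      cnt (fun w => G.Adj v w ∧ p w = some (i + 4)) + (e₁ + e₂)) ∧
    (∀ i, k ≤ cnt (fun w => p w = some (i + 1)) + cnt (fun w => p w = some (i + 4)) + (e₁ + e₂)) ∧
    (∀ i, cnt (fun w => p w = some i) + 2 * k ≤ Fintype.card Ω + 2 * (e₁ + e₂)) ∧
    (∀ i, 3 * k ≤ cnt (fun w => p w = some i) + Fintype.card Ω + 3 * (e₁ + e₂)) := by
  have h1 : ∀ v i, p v = some i → k ≤ cnt (fun w => G.Adj v w ∧ p w = some (i + 1)) +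
      cnt (fun w => G.Adj v w ∧ p w = some (i + 4)) + (e₁ + e₂) := by
    intro v i hv
    rw [← hk v]
    refine (cnt_le_add (q := fun w => (G.Adj v w ∧ p w = some (i + 1)) ∨
      (G.Adj v w ∧ p w = some (i + 4))) (r := fun w => p w = none ∨
      (G.Adj v w ∧ ∃ j, p w = some j ∧ ¬ (j = i + 1 ∨ i = j + 1))) fun w hw => ?_).trans
      (add_le_add (cnt_le_add fun w h => h) ((cnt_le_add fun w h => h).trans
        (add_le_add hp0 (hp1 v i hv))))
    rcases hpw : p w with _ | j
    · simp
    · have := pentagon_adj_iff i j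
      simp only [hw, true_and, Option.some.injEq]
      by_cases hj : j = i + 1 ∨ i = j + 1
      · exact Or.inl (this.1 hj)
      · exact Or.inr (Or.inr ⟨j, rfl, hj⟩)
  have h2 : ∀ i, k ≤ cnt (fun w => p w = some (i + 1)) + cnt (fun w => p w = some (i + 4)) +
      (e₁ + e₂) := by
    intro i
    obtain ⟨v, hv⟩ := hp2 i
    refine (h1 v i hv).trans ?_
    gcongr <;> exact cnt_mono fun w h => h.2
  have hs := sum_cnt_fiber p
  rw [Fintype.sum_option] at hs
  have key : ∀ i : Fin 5, i + 2 + 1 = i + 3 ∧ i + 2 + 4 = i + 1 ∧ i + 3 + 1 = i + 4 ∧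
    i + 3 + 4 = i + 2 := by decide
  have h3 : ∀ i, cnt (fun w => p w = some i) + 2 * k ≤ Fintype.card Ω + 2 * (e₁ + e₂) := by
    intro i
    -- Around `i + 2` lie the classes `i + 1, i + 3`, around `i + 3` the classes `i + 2, i + 4`.
    -- Each pair fills about `k` vertices and together they leave out exactly class `i`.
    have h4 := h2 (i + 2)
    have h5 := h2 (i + 3)
    have h6 := sum_fin_five_shift (fun j => cnt (fun w => p w = some j)) i
    obtain ⟨k1, k2, k3, k4⟩ := key i
    rw [k1, k2] at h4
    rw [k3, k4] at h5
    omega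
  refine ⟨h1, h2, h3, fun i => ?_⟩
  -- The classes `i` and `i + 3` surround `i + 4`, so the upper bound on class `i + 3` gives a lower
  -- bound on class `i`.
  have h4 := h2 (i + 4)
  have h5 := h3 (i + 3)
  have k1 : i + 4 + 1 = i := (by decide : ∀ i : Fin 5, i + 4 + 1 = i) i
  have k2 : i + 4 + 4 = i + 3 := (by decide : ∀ i : Fin 5, i + 4 + 4 = i + 3) i
  rw [k1, k2] at h4
  omega

theorem exists_hasMatched_of_almost_pentagon (t : ℕ) :
    ∃ δ₀ : ℝ, 0 < δ₀ ∧ ∀ δ, 0 < δ → δ ≤ δ₀ → ∃ N : ℕ, ∀ {Ω : Type u} [Fintype Ω]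
      (G : SimpleGraph Ω) (k : ℕ), N ≤ Fintype.card Ω →
      ¬ HasWheel G t → (∀ v, cnt (G.Adj v) = k) → 2 * Fintype.card Ω < 5 * k →
      ∀ p : Ω → Option (Fin 5), (cnt (fun v => p v = none) : ℝ) ≤ 11 * δ * Fintype.card Ω →
        (∀ v i, p v = some i →
          (cnt (fun w => G.Adj v w ∧ ∃ j, p w = some j ∧ ¬ (j = i + 1 ∨ i = j + 1)) : ℝ) ≤
            δ * Fintype.card Ω) →
        (∀ i, ∃ v, p v = some i) → HasMatched G t := by
  obtain ⟨η₀, hη₀, N₁, hN₁⟩ := exists_hasMatched.{u} t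
  obtain ⟨θ, hθ, hθη₀, hθ100⟩ : ∃ θ : ℝ, 0 < θ ∧ 6 * θ ≤ η₀ ∧ 6 * θ ≤ 1 / 100 := by
    refine ⟨min η₀ (1 / 100) / 6, by positivity, ?_, ?_⟩
    · linarith [min_le_left η₀ (1 / 100)]
    · linarith [min_le_right η₀ (1 / 100)]
  obtain ⟨N₂, hN₂⟩ := exists_hasWheel.{u} (c := θ / 2) (by positivity) t
  refine ⟨θ / 200, by positivity, fun δ hδ hδθ => ⟨max N₁ N₂, ?_⟩⟩
  intro Ω _ G k hn hW hk hkn p hp0 hp1 hp2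
  have hn1 := (le_max_left _ _).trans hn
  have hn2 := (le_max_right _ _).trans hn
  set n := Fintype.card Ω
  have hkn' : (2 * n : ℝ) ≤ 5 * k := by exact_mod_cast hkn.le
  have hn0 : (0 : ℝ) ≤ n := by positivity
  have hδn0 : 0 ≤ δ * n := by positivity
  have hδn : δ * n ≤ θ / 200 * n := by gcongr
  have hθn : 6 * θ * n ≤ 1 / 100 * n := by gcongr
  have hθn0 : 0 ≤ θ * n := by positivity
  obtain ⟨s1, s2, s3, s4⟩ := pentagon_class_sizes (e₁ := ⌊11 * δ * n⌋₊) (e₂ := ⌊δ * n⌋₊) hk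
    (Nat.le_floor hp0) (fun v i hv => Nat.le_floor (hp1 v i hv)) hp2
  have hp0' : cnt (fun v => p v = none) ≤ ⌊11 * δ * n⌋₊ := Nat.le_floor hp0
  have he₁ : (⌊11 * δ * n⌋₊ : ℝ) ≤ 11 * δ * n := Nat.floor_le (by positivity)
  have he₂ : (⌊δ * n⌋₊ : ℝ) ≤ δ * n := Nat.floor_le (by positivity)
  generalize ⌊11 * δ * n⌋₊ = e₁ at *
  generalize ⌊δ * n⌋₊ = e₂ at *
  have step1 : ∀ v, ∃ j, (cnt (fun w => G.Adj v w ∧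
      ∃ l, p w = some l ∧ ¬ (l = j + 1 ∨ j = l + 1)) : ℝ) ≤ 5 * θ * n ∧
      ∀ i, p v = some i → j = i := by
    intro v
    rcases hv : p v with _ | i
    swap
    · exact ⟨i, (hp1 v i hv).trans (by linarith), fun i' h => Option.some.inj h⟩
    let X : Fin 5 → ℕ := fun l => cnt (fun w => G.Adj v w ∧ p w = some l)
    -- A vertex of class `l` misses fewer than `5 * (e₁ + e₂)` vertices of class `l + 1`, because
    -- `5k > 2n`. So `θ * n` neighbors of `v` in each of two consecutive classes would give a wheel.
    obtain ⟨j, hj⟩ := exists_of_pentagon_independent (fun l => θ * n < X l) (by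
      intro l h1 h2
      refine hW (hN₂ G v (fun x => G.Adj v x ∧ p x = some l) hn2 (by linarith)
        (fun x hx => hx.1) ?_)
      rintro x ⟨-, hx⟩
      have h3 := s1 x l hx
      have h4 := cnt_add_le_of_imp (q := fun w => G.Adj x w ∧ p w = some (l + 1))
        (r := fun w => G.Adj v w ∧ p w = some (l + 1)) (s := fun w => p w = some (l + 1))
        (fun x h => h.2) (fun x h => h.2)
      have h5 : cnt (fun w => (G.Adj x w ∧ p w = some (l + 1)) ∧ G.Adj v w ∧ p w = some (l + 1)) ≤
        cnt (fun w => G.Adj v w ∧ G.Adj x w) := cnt_mono fun w h => ⟨h.2.1, h.1.1⟩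
      have h6 : cnt (fun w => G.Adj x w ∧ p w = some (l + 4)) ≤ cnt (fun w => p w = some (l + 4)) :=
        cnt_mono fun w h => h.2
      have h7 := s3 (l + 1)
      have h8 := s3 (l + 4)
      have h9 : X (l + 1) + 5 * k ≤ cnt (fun w => G.Adj v w ∧ G.Adj x w) + 2 * n +
          5 * (e₁ + e₂) := by
        simp only [X]
        omega
      have h10 : (X (l + 1) + 5 * k : ℝ) ≤ cnt (fun w => G.Adj v w ∧ G.Adj x w) + 2 * n +
          5 * (e₁ + e₂) := by exact_mod_cast h9
      linarith)
    refine ⟨j, ?_, by simp⟩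
    have h1 : cnt (fun w => G.Adj v w ∧ ∃ l, p w = some l ∧ ¬ (l = j + 1 ∨ j = l + 1)) ≤
        ∑ l, cnt (fun w => (G.Adj v w ∧ p w = some l) ∧ ¬ (l = j + 1 ∨ j = l + 1)) :=
      cnt_le_sum fun w ⟨h, l, h2, h3⟩ => ⟨l, ⟨h, h2⟩, h3⟩
    have h2 : ∀ l, (cnt (fun w => (G.Adj v w ∧ p w = some l) ∧ ¬ (l = j + 1 ∨ j = l + 1)) : ℝ) ≤
        θ * n := by
      intro l
      by_cases hl : l = j + 1 ∨ j = l + 1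
      · rw [cnt_congr (q := fun _ => False) fun w => by simp [hl], cnt_false]
        simpa using hθn0
      · have h3 := not_lt.1 fun h => hl (hj l h)
        refine le_trans ?_ h3
        exact_mod_cast cnt_mono (p := fun w => (G.Adj v w ∧ p w = some l) ∧
          ¬ (l = j + 1 ∨ j = l + 1)) fun w h => h.1
    calc (cnt (fun w => G.Adj v w ∧ ∃ l, p w = some l ∧ ¬ (l = j + 1 ∨ j = l + 1)) : ℝ)
        ≤ ∑ l, (cnt (fun w => (G.Adj v w ∧ p w = some l) ∧ ¬ (l = j + 1 ∨ j = l + 1)) : ℝ) := by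
          exact_mod_cast h1
      _ ≤ ∑ l : Fin 5, θ * n := sum_le_sum fun l _ => h2 l
      _ = 5 * θ * n := by simp; ring
  choose c hc hcp using step1
  have hcn : ∀ v, (cnt (fun w => G.Adj v w ∧ ¬ (c w = c v + 1 ∨ c v = c w + 1)) : ℝ) ≤
      6 * θ * n := by
    intro v
    have h1 : cnt (fun w => G.Adj v w ∧ ¬ (c w = c v + 1 ∨ c v = c w + 1)) ≤
        cnt (fun w => G.Adj v w ∧ ∃ l, p w = some l ∧ ¬ (l = c v + 1 ∨ c v = l + 1)) +
        cnt (fun w => p w = none) := by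
      refine cnt_le_add fun w hw => ?_
      rcases h : p w with _ | l
      · exact Or.inr rfl
      · exact Or.inl ⟨hw.1, l, rfl, by rw [← hcp w l h]; exact hw.2⟩
    have h2 : (cnt (fun w => G.Adj v w ∧ ¬ (c w = c v + 1 ∨ c v = c w + 1)) : ℝ) ≤
        cnt (fun w => G.Adj v w ∧ ∃ l, p w = some l ∧ ¬ (l = c v + 1 ∨ c v = l + 1)) +
        cnt (fun w => p w = none) := by
      exact_mod_cast h1
    have h3 := hc v
    linarith
  have hcu : ∀ i, cnt (fun v => c v = i) ≤ cnt (fun v => p v = some i) + e₁ := by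
    intro i
    refine (cnt_le_add (r := fun v => p v = none) fun v hv => ?_).trans
      (Nat.add_le_add_left ?_ _)
    · rcases h : p v with _ | l
      · exact Or.inr rfl
      · exact Or.inl (by rw [← hcp v l h, hv])
    · exact hp0'
  have hcl : ∀ i, cnt (fun v => p v = some i) ≤ cnt (fun v => c v = i) := fun i =>
    cnt_mono fun v hv => hcp v i hv
  have hout : ∀ u, k ≤ cnt (fun w => G.Adj u w ∧ c w = c u + 1) +
      cnt (fun w => G.Adj u w ∧ c w = c u + 4) +
      cnt (fun w => G.Adj u w ∧ ¬ (c w = c u + 1 ∨ c u = c w + 1)) := by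
    intro u
    rw [← hk u]
    refine (cnt_le_add (q := fun w => (G.Adj u w ∧ c w = c u + 1) ∨
      (G.Adj u w ∧ c w = c u + 4)) fun w hw => ?_).trans
      (Nat.add_le_add_right (cnt_le_add fun w h => h) _)
    have := pentagon_adj_iff (c u) (c w)
    tauto
  let F : SimpleGraph Ω :=
    { Adj := fun u w => G.Adj u w ∧ ¬ (c w = c u + 1 ∨ c u = c w + 1)
      symm := ⟨fun u w h => ⟨h.1.symm, fun h' => h.2 h'.symm⟩⟩
      loopless := ⟨fun u h => h.1.ne rfl⟩ }
  refine hN₁ G F (fun u w h => h.1) hn1 (fun v => ?_) ?_ ?_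
  · have h3 : 6 * θ * n ≤ η₀ * n := by gcongr
    exact (hcn v).trans h3
  · have hs := sum_cnt_fiber c
    -- The sums of the sizes of the two neighboring classes add up to `2n < 5k`. Every vertex of the
    -- class `j` found here then has a wrong edge, and this class has linear size.
    obtain ⟨j, hj⟩ : ∃ j, cnt (fun v => c v = j + 1) + cnt (fun v => c v = j + 4) < k := by
      by_contra! h
      have h0 := h 0
      have h1 := h 1
      have h2 := h 2
      have h3 := h 3
      have h4 := h 4
      rw [Fin.sum_univ_five] at hs
      simp only [Fin.reduceAdd, zero_add] at h0 h1 h2 h3 h4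
      omega
    have h1 : ∀ v, c v = j → 1 ≤ cnt (F.Adj v) := by
      intro v hv
      have h2 := hout v
      have h3 : cnt (fun w => G.Adj v w ∧ c w = c v + 1) ≤ cnt (fun w => c w = j + 1) :=
        cnt_mono fun w h => hv ▸ h.2
      have h4 : cnt (fun w => G.Adj v w ∧ c w = c v + 4) ≤ cnt (fun w => c w = j + 4) :=
        cnt_mono fun w h => hv ▸ h.2
      change 1 ≤ cnt (fun w => G.Adj v w ∧ ¬ (c w = c v + 1 ∨ c v = c w + 1))
      omega
    have h2 : cnt (fun v => c v = j) ≤ ∑ v, cnt (F.Adj v) := by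
      rw [cnt, card_filter]
      refine sum_le_sum fun v _ => ?_
      split_ifs with hv
      · exact h1 v hv
      · exact Nat.zero_le _
    have h3 := s4 j
    have h4 := hcl j
    have h5 : (3 * k : ℝ) ≤ ∑ v, cnt (F.Adj v) + n + 3 * (e₁ + e₂) := by
      norm_cast
      omega
    linarith
  · rintro u w ⟨-, huw⟩
    -- Equal or non-adjacent pentagon vertices have a common neighbor `i`; both ends of the wrong
    -- edge see nearly all of class `i`.
    have key : ∀ a b : Fin 5, ¬ (b = a + 1 ∨ a = b + 1) →
        ∃ i, (i = a + 1 ∨ i = a + 4) ∧ (i = b + 1 ∨ i = b + 4) := by decide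
    obtain ⟨i, hiu, hiw⟩ := key _ _ huw
    have hnon : ∀ u, (i = c u + 1 ∨ i = c u + 4) → cnt (fun v => c v = i) + 5 * k ≤
        cnt (fun y => G.Adj u y ∧ c y = i) + 2 * n + 6 * (e₁ + e₂) +
        cnt (fun w => G.Adj u w ∧ ¬ (c w = c u + 1 ∨ c u = c w + 1)) := by
      intro u hu
      have h1 := hout u
      have h2 := s3 (c u + 1)
      have h3 := s3 (c u + 4)
      have h4 := hcu (c u + 1)
      have h5 := hcu (c u + 4)
      have h6 : cnt (fun w => G.Adj u w ∧ c w = c u + 1) ≤ cnt (fun w => c w = c u + 1) :=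
        cnt_mono fun w h => h.2
      have h7 : cnt (fun w => G.Adj u w ∧ c w = c u + 4) ≤ cnt (fun w => c w = c u + 4) :=
        cnt_mono fun w h => h.2
      rcases hu with rfl | rfl <;> omega
    have h1 := cnt_add_le_of_imp (q := fun y => G.Adj u y ∧ c y = i)
      (r := fun y => G.Adj w y ∧ c y = i) (s := fun y => c y = i)
      (fun x h => h.2) (fun x h => h.2)
    have h2 : cnt (fun y => (G.Adj u y ∧ c y = i) ∧ G.Adj w y ∧ c y = i) ≤
      cnt (fun y => G.Adj u y ∧ G.Adj w y) := cnt_mono fun y h => ⟨h.1.1, h.2.1⟩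
    have h3 := hnon u hiu
    have h4 := hnon w hiw
    have h5 := hcn u
    have h6 := hcn w
    have h7 := s4 i
    have h8 := hcl i
    have h9 : (13 * k : ℝ) ≤ cnt (fun y => G.Adj u y ∧ G.Adj w y) + 5 * n + 15 * (e₁ + e₂) +
        cnt (fun y => G.Adj u y ∧ ¬ (c y = c u + 1 ∨ c u = c y + 1)) +
        cnt (fun y => G.Adj w y ∧ ¬ (c y = c w + 1 ∨ c w = c y + 1)) := by
      norm_cast
      omega
    linarith

/-! ### The upper bound for odd orders and the theorem -/

theorem regularTuranNumber_le_of_odd {V : Type*} [Fintype V] {H : SimpleGraph V} {v : V}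
    (hv : (H.induce {v}ᶜ).IsBipartite)
    (hH : H.IsContained (matchedCompleteBipartiteGraph (Fintype.card V) (Fintype.card V))) :
    ∃ N : ℕ, ∀ n : ℕ, N ≤ n → Odd n → regularTuranNumber n H ≤ 2 * (n / 5) := by
  set t := Fintype.card V
  obtain ⟨δ₁, hδ₁, h1⟩ := exists_hasMatched_of_almost_bipartite.{0} t
  obtain ⟨δ₂, hδ₂, h2⟩ := exists_hasMatched_of_almost_pentagon.{0} t
  have hδ : 0 < min δ₁ δ₂ := lt_min hδ₁ hδ₂
  obtain ⟨N₁, hN₁⟩ := h1 _ hδ (min_le_left _ _)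
  obtain ⟨N₂, hN₂⟩ := h2 _ hδ (min_le_right _ _)
  obtain ⟨N₃, hN₃⟩ := exists_almost_bipartite_or_pentagon.{0} hδ t
  refine ⟨max N₁ (max N₂ N₃), fun n hn hodd => csSup_le' ?_⟩
  rintro k ⟨G, hG, hfree⟩
  by_contra! hk
  have hn1 : N₁ ≤ Fintype.card (Fin n) := by
    rw [Fintype.card_fin]; exact (le_max_left _ _).trans hn
  have hn2 : N₂ ≤ Fintype.card (Fin n) := by
    rw [Fintype.card_fin]; exact (le_max_left _ _).trans ((le_max_right _ _).trans hn)
  have hn3 : N₃ ≤ Fintype.card (Fin n) := by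
    rw [Fintype.card_fin]; exact (le_max_right _ _).trans ((le_max_right _ _).trans hn)
  have hreg : ∀ v, cnt (G.Adj v) = k := fun v => by
    rw [cnt_adj_eq_degree, ← hG.degree_eq v]
  have heven : Even k := by
    have h3 := G.sum_degrees_eq_twice_card_edges
    simp only [hG.degree_eq, sum_const, card_univ, Fintype.card_fin, smul_eq_mul] at h3
    have h4 : Even (n * k) := ⟨_, h3.trans (two_mul _)⟩
    exact (Nat.even_mul.1 h4).resolve_left (Nat.not_even_iff_odd.2 hodd)
  -- Evenness matters: `k > 2⌊n/5⌋` then means `k / 2 ≥ ⌊n/5⌋ + 1 > n / 5`.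
  have hkn : 2 * Fintype.card (Fin n) < 5 * k := by
    rw [Fintype.card_fin]
    obtain ⟨m, hm⟩ := heven
    omega
  have hW : ¬ HasWheel G t := fun h => hfree (SimpleGraph.isContained_of_hasWheel hv h)
  have hM : ¬ HasMatched G t := fun h =>
    hfree (hH.trans (matchedCompleteBipartiteGraph_isContained_of_hasMatched h))
  rcases hN₃ G k hn3 hW hreg hkn with ⟨p, hp0, hp1⟩ | ⟨p, hp0, hp1, hp2⟩
  · exact hM (hN₁ G k hn1 (by rwa [Fintype.card_fin]) hW hreg hkn p hp0 hp1)
  · exact hM (hN₂ G k hn2 hW hreg hkn p hp0 hp1 hp2)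
end

theorem mainTheorem3 {V : Type*} [Fintype V] (H : SimpleGraph V) (hH : H.chromaticNumber = 3) :
    (((∀ v : V, ¬ (H.induce {v}ᶜ).IsBipartite) ∨
        ¬ H.IsContained (matchedCompleteBipartiteGraph (Fintype.card V) (Fintype.card V))) →
      (fun n : ℕ => (regularTuranNumber n H : ℝ) - (n : ℝ) / 2) =o[Filter.atTop]
        (fun n : ℕ => (n : ℝ))) ∧
    (¬ ((∀ v : V, ¬ (H.induce {v}ᶜ).IsBipartite) ∨
        ¬ H.IsContained (matchedCompleteBipartiteGraph (Fintype.card V) (Fintype.card V))) →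
      ∃ N : ℕ, ∀ n : ℕ, N ≤ n → Odd n → regularTuranNumber n H ≤ 2 * (n / 5)) := by
  have h3 : H.Colorable 3 := SimpleGraph.chromaticNumber_le_iff_colorable.1 hH.le
  have h2 : ¬ H.Colorable 2 := fun h => by
    have := SimpleGraph.chromaticNumber_le_iff_colorable.2 h
    rw [hH] at this
    exact absurd this (by decide)
  refine ⟨regularTuranNumber_isLittleO h3 h2, fun h => ?_⟩
  push Not at h
  obtain ⟨⟨v, hv⟩, hc⟩ := h
  exact regularTuranNumber_le_of_odd hv hc
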